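/- **Theorem (unordered multinomial probit model).** Let $K\ge 2$, let $X$ be a random element of $L^1[0,1]$ with law $G$, and suppose that $\|X\|_1=\int_0^1|X(t)|\,dt$ is almost surely bounded by a constant. For coefficient functions $\beta=(\beta_1,\dots,\beta_{K-1})$ on $[0,1]$ let $$W_l=\int_0^1\beta_l(t)X(t)\,dt+\varepsilon_l,\qquad l=1,\dots,K-1,$$ where $(\varepsilon_1,\dots,\varepsilon_{K-1})\sim N(0,\Sigma)$ is independent of $X$, and $\Sigma$ has $2$ on the diagonal and $1$ off the diagonal (that is, $\varepsilon_l=\varepsilon'_l-\varepsilon'_K$ with $\varepsilon'_1,\dots,\varepsilon'_K$ i.i.d. $N(0,1)$). Put $\pi_k(X)=P(W_k>W_l\text{ for all }l\ne k,\ W_k>0\mid X)$ for $k<K$ and $\pi_K(X)=P(W_l<0\text{ for all }l\mid X)$. Let $(X_1,Y_1),\dots,(X_n,Y_n)$ be i.i.d. with $X_i\sim G$ and $P(Y_i=k\mid X_i)=\pi_{0k}(X_i)$, where $\pi_0$ is given by the true coefficient functions $\beta_{01},\dots,\beta_{0,K-1}$, and let $$d(\pi,\pi_0)=\Big(\sum_{k=1}^K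 E_X|\pi_k(X)-\pi_{0k}(X)|^2\Big)^{1/2}.$$ *Prior.* For each $J$ let $\psi_J=(\psi_{J,1},\dots,\psi_{J,J})$ be measurable basis functions. The prior on $\beta$ is the law of $\beta_l=\theta_l^T\psi_J$, $l<K$, where $J$ is random and, given $J$, $\Theta=(\theta_1,\dots,\theta_{K-1})\in(\mathbb R^J)^{K-1}$ has an arbitrary joint law, such that, with numbers $0\le t_2\le t_1\le 1$, $H$, and with constants $c_1,c_2,c_3,C,t_3,\epsilon_0,M_0>0$ and $s\ge0$ not depending on $J$: * (A1) $\exp\{-c_1 j\log^{t_1}j\}\le\Pi(J=j)\le\exp\{-c_2 j\log^{t_2}j\}$ for all sufficiently large $j$; * (A2) for all $J\ge1$, all $\Theta_0$ with $\|\Theta_0\|_\infty\le H$ and all $0<\epsilon\le\epsilon_0J^{-s}$, $\Pi(\|\Theta-\Theta_0\|_2\le\epsilon\mid J)\ge\exp\{-c_3J\log(1/\epsilon)\}$; and for all $J$ and all $M\ge M_0$, the conditional probability given $J$ that some entry of $\Theta$ lies outside $[-M,M]$ is at most $J\exp\{-CM^{t_3}\}$. *Basis.* Assume that, for some $\alpha>0$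 and $K_0\ge0$, and constants $C_1,C_2$ not depending on $J\geq 1$, * (5.10) for every $l<K$ and $J\ge1$ there is $\theta_0\in\mathbb R^J$ with $\|\theta_0\|_\infty\le H$ and $\sup_{t\in[0,1]}|\beta_{0l}(t)-\theta_0^T\psi_J(t)|\le C_1J^{-\alpha}$; * (5.11) $\sup_{t\in[0,1]}|\theta_1^T\psi_J(t)-\theta_2^T\psi_J(t)|\le C_2J^{K_0}\|\theta_1-\theta_2\|_2$ for all $J\geq 1$ and $\theta_1,\theta_2\in\mathbb R^J$. Then, for every positive sequence $\epsilon_n\asymp n^{-\alpha/(2\alpha+1)}(\log n)^{\alpha/(2\alpha+1)+(1-t_2)/2}$, the posterior contracts at rate $\epsilon_n$ relative to $d$: for every $M_n\to\infty$, $$\Pi\big(d(\pi,\pi_0)\ge M_n\epsilon_n\,\big|\,X_1,Y_1,\dots,X_n,Y_n\big)\to0\quad\text{in probability under the true law of the data.}$$ -/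

import Mathlib

open MeasureTheory ProbabilityTheory Filter Topology Asymptotics

noncomputable section

namespace FunProbit

/-- The space `L¹[0,1]` in which the functional covariate takes its values. -/
abbrev Curve : Type := Lp ℝ 1 (volume.restrict (Set.Icc (0 : ℝ) 1))

instance instMeasurableSpaceCurve : MeasurableSpace Curve := borel Curve

instance instBorelSpaceCurve : BorelSpace Curve := ⟨rfl⟩

/-! ### The unordered multinomial probit model with `K = q + 1` categories

The category `K` is `Fin.last q`; the categories `1, …, K - 1` are `i.castSucc` for `i : Fin q`. -/

/-- The law of `(ε'_l - ε'_K)_{l < K}` for i.i.d. standard normal `ε'_1, …, ε'_K`: the centred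
normal law whose covariance matrix has `2` on the diagonal and `1` off the diagonal. -/
def latentNoise (q : ℕ) : Measure (Fin q → ℝ) :=
  (Measure.pi (fun _ : Fin (q + 1) => gaussianReal 0 1)).map
    (fun e l => e l.castSucc - e (Fin.last q))

/-- The latent vector `w = (w_1, …, w_{K-1})` selects category `k`: for `k < K` this means
`w_k > w_l` for all `l ≠ k` and `w_k > 0`; for `k = K` it means `w_l < 0` for all `l`. -/
def Selects {q : ℕ} (w : Fin q → ℝ) (k : Fin (q + 1)) : Prop :=
  Fin.lastCases (motive := fun _ => Prop)
    (∀ l, w l < 0)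
    (fun i => (∀ l, l ≠ i → w l < w i) ∧ 0 < w i) k

/-- The linear predictor `∫₀¹ β(t) x(t) dt`. -/
def linPred (β : ℝ → ℝ) (x : Curve) : ℝ :=
  ∫ t in Set.Icc (0 : ℝ) 1, β t * x t

/-- `π_k(x) = P(Y = k | X = x)` for coefficient functions `β_1, …, β_{K-1}`: the probability that
`W_l = ∫ β_l x + ε_l`, `l < K`, selects `k`. -/
def catProb {q : ℕ} (β : Fin q → ℝ → ℝ) (x : Curve) (k : Fin (q + 1)) : ℝ :=
  (latentNoise q).real {e | Selects (fun l => linPred (β l) x + e l) k}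

/-- The joint law of one observation `(X, Y)` when `X` has law `G`: it has density `π_y(x)` with
respect to the product of `G` and the counting measure on the categories. -/
def obsLaw {q : ℕ} (G : Measure Curve) (β : Fin q → ℝ → ℝ) : Measure (Curve × Fin (q + 1)) :=
  (G.prod Measure.count).withDensity (fun z => ENNReal.ofReal (catProb β z.1 z.2))

/-- The distance `d(π, π')`, the square root of `∑_k E_X |π_k(X) - π'_k(X)|²`, between the
category probabilities of two vectors of coefficient functions. -/
def catDist {q : ℕ} (G : Measure Curve) (β β' : Fin q → ℝ → ℝ) : ℝ :=
  Real.sqrt (∑ k : Fin (q + 1), ∫ x, |catProb β x k - catProb β' x k| ^ 2 ∂G)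

/-! ### Finite random series priors and the posterior -/

/-- The coefficient parameter `(J, Θ)`: `Θ l j` is the coefficient of the `j`-th of `J` basis
functions in `β_l`. -/
abbrev Param (q : ℕ) : Type := Σ J : ℕ, (Fin q → Fin J → ℝ)

/-- The finite series `θᵀψ`, where `ψ J 0, …, ψ J (J - 1)` are the basis functions used in
dimension `J`. -/
def series (ψ : (J : ℕ) → Fin J → ℝ → ℝ) {J : ℕ} (θ : Fin J → ℝ) (t : ℝ) : ℝ :=
  ∑ j, θ j * ψ J j t

/-- The coefficient functions `β_l = θ_lᵀψ` given by a parameter `(J, Θ)`. -/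
def coefFun {q : ℕ} (ψ : (J : ℕ) → Fin J → ℝ → ℝ) (p : Param q) : Fin q → ℝ → ℝ :=
  fun l => series ψ (p.2 l)

/-- The prior: `J` has law `ρ`, and given `J` the coefficients `Θ` have law `τ J`. -/
def prior {q : ℕ} (ρ : Measure ℕ) (τ : (J : ℕ) → Measure (Fin q → Fin J → ℝ)) :
    Measure (Param q) :=
  Measure.sum (fun J => ρ {J} • (τ J).map (Sigma.mk J))

/-- The likelihood of a parameter given the observations `(X_1, Y_1), …, (X_n, Y_n)`. -/
def likelihood {q n : ℕ} (ψ : (J : ℕ) → Fin J → ℝ → ℝ) (D : Fin n → Curve × Fin (q + 1))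
    (p : Param q) : ENNReal :=
  ∏ i, ENNReal.ofReal (catProb (coefFun ψ p) (D i).1 (D i).2)

/-- The posterior probability of a set `B` of parameters, by Bayes's formula. -/
def posteriorProb {q n : ℕ} (P : Measure (Param q)) (ψ : (J : ℕ) → Fin J → ℝ → ℝ)
    (D : Fin n → Curve × Fin (q + 1)) (B : Set (Param q)) : ENNReal :=
  (∫⁻ p in B, likelihood ψ D p ∂P) / ∫⁻ p, likelihood ψ D p ∂P

/-- The posterior contracts at rate `r` at the true coefficient functions `β₀`, relative to
`catDist`: for all `M_n → ∞`, the posterior probability of `d(π, π₀) ≥ M_n r_n` tends to `0` in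
probability under the law of `n` i.i.d. observations with true coefficient functions `β₀`. -/
def ContractsAt {q : ℕ} (G : Measure Curve) (P : Measure (Param q))
    (ψ : (J : ℕ) → Fin J → ℝ → ℝ) (β₀ : Fin q → ℝ → ℝ) (r : ℕ → ℝ) : Prop :=
  ∀ M : ℕ → ℝ, Tendsto M atTop atTop →
    ∀ δ : ENNReal, 0 < δ →
      Tendsto
        (fun n : ℕ => Measure.pi (fun _ : Fin n => obsLaw G β₀)
          {D | δ ≤ posteriorProb P ψ D {p | M n * r n ≤ catDist G (coefFun ψ p) β₀}})
        atTop (𝓝 0)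

/-! ### Conditions on the prior and the basis -/

/-- The condition on the law `ρ` of `J`:
`exp(-c₁ j log^{t₁} j) ≤ ρ(J = j) ≤ exp(-c₂ j log^{t₂} j)` for all large `j`. -/
def DimPriorCond (ρ : Measure ℕ) (t₁ t₂ : ℝ) : Prop :=
  ∃ c₁ > (0 : ℝ), ∃ c₂ > (0 : ℝ), ∃ j₀ : ℕ, ∀ j ≥ j₀,
    Real.exp (-c₁ * j * Real.log j ^ t₁) ≤ ρ.real {j} ∧
      ρ.real {j} ≤ Real.exp (-c₂ * j * Real.log j ^ t₂)

/-- The small-ball condition on the law `τ J` of the coefficients given `J`. The range in which `ε`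
is small enough may shrink polynomially in `J`: a range `(0, ε₀]` that is the same for all `J`
(the case `s = 0`) is impossible for every family of probability laws when `H > 0`, because the cube
`[-H, H]^J` contains too many disjoint `ε`-balls. -/
def CoefPriorConc {q : ℕ} (τ : (J : ℕ) → Measure (Fin q → Fin J → ℝ)) (H : ℝ) : Prop :=
  ∃ c₃ > (0 : ℝ), ∃ ε₀ > (0 : ℝ), ∃ s ≥ (0 : ℝ), ∀ J : ℕ, 1 ≤ J →
    ∀ Θ₀ : Fin q → Fin J → ℝ, (∀ l j, |Θ₀ l j| ≤ H) →
      ∀ ε : ℝ, 0 < ε → ε ≤ ε₀ * (J : ℝ) ^ (-s) →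
        Real.exp (-c₃ * J * Real.log (1 / ε)) ≤
          (τ J).real {Θ | Real.sqrt (∑ l, ∑ j, (Θ l j - Θ₀ l j) ^ 2) ≤ ε}

/-- The tail condition on the law `τ J` of the coefficients given `J`: the probability that some
coefficient lies outside `[-M, M]` is at most `J exp(-C M^{t₃})`, for all large `M`. -/
def CoefPriorTail {q : ℕ} (τ : (J : ℕ) → Measure (Fin q → Fin J → ℝ)) : Prop :=
  ∃ C > (0 : ℝ), ∃ t₃ > (0 : ℝ), ∃ M₀ > (0 : ℝ), ∀ J : ℕ, ∀ M ≥ M₀,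
    (τ J).real {Θ | ∃ l j, M < |Θ l j|} ≤ J * Real.exp (-C * M ^ t₃)

/-- Approximation of `β₀` by the basis in the uniform norm, at rate `J^{-α}`, by coefficient vectors
bounded by `H`. -/
def BasisApprox (ψ : (J : ℕ) → Fin J → ℝ → ℝ) (β₀ : ℝ → ℝ) (α H : ℝ) : Prop :=
  ∃ C > (0 : ℝ), ∀ J : ℕ, 1 ≤ J → ∃ θ₀ : Fin J → ℝ, (∀ j, |θ₀ j| ≤ H) ∧
    ∀ t ∈ Set.Icc (0 : ℝ) 1, |β₀ t - series ψ θ₀ t| ≤ C * (J : ℝ) ^ (-α)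

/-- Stability of the basis in the uniform norm, with exponent `K₀`. -/
def BasisStable (ψ : (J : ℕ) → Fin J → ℝ → ℝ) (K₀ : ℝ) : Prop :=
  ∃ C > (0 : ℝ), ∀ J : ℕ, 1 ≤ J → ∀ θ₁ θ₂ : Fin J → ℝ, ∀ t ∈ Set.Icc (0 : ℝ) 1,
    |series ψ θ₁ t - series ψ θ₂ t| ≤
      C * (J : ℝ) ^ K₀ * Real.sqrt (∑ j, (θ₁ j - θ₂ j) ^ 2)

end FunProbit

end

/-!
Each category probability of the probit model is bounded away from `0` on bounded curves, and it is
Lipschitz in the linear predictors. So for coefficient functions uniformly close to `β₀` the inverse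
likelihood ratio has mean close to `1` under the truth, and by Markov's inequality the prior mass
near the truth bounds the marginal likelihood from below by `exp (-a n δ_n²)`, where
`n δ_n² = optDim n * log n` is the cost of the best dimension `optDim n = (n / log n)^{1/(2α+1)}`.

On the other side, the square roots of the likelihood ratios have mean at most `1 - d²/8`, since
the Hellinger affinity is controlled by `d`. A sieve of bounded dimension and coefficients is
covered by cells on which the category probabilities hardly vary. The likelihood ratios of a cell
lie below a common bracket, so Markov's inequality and a union bound over the cells replace the
construction of tests. The remaining prior mass outside the sieve is exponentially small and is
handled by Fubini's theorem.
-/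

noncomputable section

namespace FunProbit

open scoped ENNReal
open Real (exp log)

/-! ### Maximising a Gaussian random utility -/

lemma gaussianReal_le_volume (m : ℝ) {v : NNReal} (hv : 1 ≤ v) (s : Set ℝ) :
    gaussianReal m v s ≤ volume s := by
  have hpdf (x : ℝ) : gaussianPDF m v x ≤ 1 := by
    rw [gaussianPDF, ENNReal.ofReal_le_one, gaussianPDFReal]
    have : (1 : ℝ) ≤ v := hv
    refine mul_le_one₀ (inv_le_one_of_one_le₀ ?_) (Real.exp_pos _).le ?_
    · rw [Real.one_le_sqrt]
      nlinarith [Real.pi_gt_three]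
    · rw [Real.exp_le_one_iff]
      exact div_nonpos_of_nonpos_of_nonneg (neg_nonpos.2 (sq_nonneg _)) (by positivity)
  rw [gaussianReal_apply m (by positivity)]
  exact (lintegral_mono hpdf).trans_eq (setLIntegral_one s)

section RandomUtility

variable {ι : Type*}

/-- The noise vectors for which alternative `k` has strictly the largest of the random utilities
`u l + e l`. -/
def winSet (u : ι → ℝ) (k : ι) : Set (ι → ℝ) :=
  {e | ∀ l, l ≠ k → u l + e l < u k + e k}

lemma measurableSet_winSet [Countable ι] (u : ι → ℝ) (k : ι) : MeasurableSet (winSet u k) := by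
  have : winSet u k = ⋂ l, ⋂ _ : l ≠ k, {e | u l + e l < u k + e k} := by
    ext; simp [winSet]
  rw [this]
  exact .iInter fun l => .iInter fun _ => measurableSet_lt (by fun_prop) (by fun_prop)

variable [Fintype ι]

/-- The law of a family of independent standard normal variables. -/
abbrev stdNormal (ι : Type*) [Fintype ι] : Measure (ι → ℝ) :=
  Measure.pi fun _ => gaussianReal 0 1

lemma map_sub_stdNormal {k l : ι} (h : l ≠ k) :
    (stdNormal ι).map (fun e => e l - e k) = gaussianReal 0 2 := by
  have hmap (i : ι) : (stdNormal ι).map (fun e => e i) = gaussianReal 0 1 :=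
    (measurePreserving_eval (fun _ : ι => gaussianReal 0 1) i).map_eq
  have hneg : (stdNormal ι).map (fun e => -e k) = gaussianReal 0 1 := by
    calc (stdNormal ι).map (fun e => -e k) = (gaussianReal 0 1).map fun x => -x := by
          rw [← hmap k, Measure.map_map (by fun_prop) (by fun_prop)]
          rfl
      _ = gaussianReal 0 1 := by rw [gaussianReal_map_neg, neg_zero]
  have hindep : IndepFun (fun e : ι → ℝ => e l) (fun e => -e k) (stdNormal ι) :=
    ((iIndepFun_pi (X := fun _ x => x) fun _ => aemeasurable_id).indepFun h).comp
      measurable_id measurable_neg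
  have hsum := gaussianReal_add_gaussianReal_of_indepFun hindep (hmap l) hneg
  rw [add_zero, one_add_one_eq_two] at hsum
  simpa only [sub_eq_add_neg] using! hsum

lemma stdNormal_sub_mem_Icc_le {k l : ι} (h : l ≠ k) {a b : ℝ} (hab : a ≤ b) :
    (stdNormal ι).real {e | e l - e k ∈ Set.Icc a b} ≤ b - a := by
  have hle : stdNormal ι {e | e l - e k ∈ Set.Icc a b} ≤ ENNReal.ofReal (b - a) :=
    calc stdNormal ι {e | e l - e k ∈ Set.Icc a b} = gaussianReal 0 2 (Set.Icc a b) := by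
          rw [← map_sub_stdNormal h, Measure.map_apply (by fun_prop) measurableSet_Icc]
          rfl
      _ ≤ ENNReal.ofReal (b - a) :=
          (gaussianReal_le_volume 0 one_le_two _).trans_eq Real.volume_Icc
  exact ENNReal.toReal_le_of_le_ofReal (sub_nonneg.2 hab) hle

/-- The probability that alternative `k` has strictly the largest of the random utilities
`u l + e l` with independent standard normal noise `e`. -/
def winProb (u : ι → ℝ) (k : ι) : ℝ := (stdNormal ι).real (winSet u k)

lemma stdNormal_exists_sub_mem_Icc_le (k : ι) (a : ι → ℝ) {d : ℝ} (hd : 0 ≤ d) :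
    (stdNormal ι).real {e | ∃ l, l ≠ k ∧ e l - e k ∈ Set.Icc (a l) (a l + d)} ≤
      Fintype.card ι * d := by
  classical
  have hcover : {e : ι → ℝ | ∃ l, l ≠ k ∧ e l - e k ∈ Set.Icc (a l) (a l + d)} =
      ⋃ l ∈ Finset.univ.erase k, {e | e l - e k ∈ Set.Icc (a l) (a l + d)} := by
    ext
    simp only [Set.mem_ofPred_eq, Set.mem_iUnion, Finset.mem_erase, Finset.mem_univ, and_true,
      exists_prop]
  calc (stdNormal ι).real {e | ∃ l, l ≠ k ∧ e l - e k ∈ Set.Icc (a l) (a l + d)}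
      ≤ ∑ l ∈ Finset.univ.erase k,
          (stdNormal ι).real {e | e l - e k ∈ Set.Icc (a l) (a l + d)} := by
        rw [hcover]
        exact measureReal_biUnion_finset_le _ _
    _ ≤ ∑ _l ∈ Finset.univ.erase k, d := Finset.sum_le_sum fun l hl =>
        (stdNormal_sub_mem_Icc_le (Finset.ne_of_mem_erase hl) (le_add_of_nonneg_right hd)).trans_eq
          (add_sub_cancel_left _ _)
    _ ≤ Fintype.card ι * d := by
        rw [Finset.sum_const, nsmul_eq_mul]
        gcongr
        exact Finset.card_le_univ _

lemma winProb_le_winProb_add {u v : ι → ℝ} {d : ℝ} (hd : 0 ≤ d) (huv : ∀ l, |u l - v l| ≤ d)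
    (k : ι) : winProb u k ≤ winProb v k + Fintype.card ι * (2 * d) := by
  have hsub : winSet u k ⊆ winSet v k ∪
      {e | ∃ l, l ≠ k ∧ e l - e k ∈ Set.Icc (u k - u l - 2 * d) (u k - u l - 2 * d + 2 * d)} := by
    intro e he
    by_contra! hnot
    simp only [Set.mem_union, winSet, Set.mem_ofPred_eq, not_or, not_forall, not_lt, not_exists,
      not_and, Set.mem_Icc, not_le] at hnot
    obtain ⟨⟨l, hl, hle⟩, hfar⟩ := hnot
    have hwin := he l hl
    have hl' := abs_le.1 (huv l)
    have hk' := abs_le.1 (huv k)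
    linarith [hfar l hl (by linarith)]
  calc winProb u k ≤ _ := (measureReal_mono hsub).trans (measureReal_union_le _ _)
    _ ≤ winProb v k + Fintype.card ι * (2 * d) := by
        gcongr
        · exact le_rfl
        · exact stdNormal_exists_sub_mem_Icc_le k _ (by positivity)

lemma abs_winProb_sub_le {u v : ι → ℝ} {d : ℝ} (hd : 0 ≤ d) (huv : ∀ l, |u l - v l| ≤ d)
    (k : ι) : |winProb u k - winProb v k| ≤ 2 * Fintype.card ι * d := by
  have hvu (l : ι) : |v l - u l| ≤ d := by rw [abs_sub_comm]; exact huv l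
  rw [abs_sub_le_iff]
  constructor
  · linarith [winProb_le_winProb_add hd huv k]
  · linarith [winProb_le_winProb_add hd hvu k]

lemma continuous_winProb (k : ι) : Continuous fun u : ι → ℝ => winProb u k := by
  refine (LipschitzWith.of_dist_le_mul (K := 2 * Fintype.card ι) fun u v => ?_).continuous
  have hle := abs_winProb_sub_le dist_nonneg (fun l => dist_le_pi_dist u v l) k
  simpa [Real.dist_eq] using hle

lemma sum_winProb [Nonempty ι] (u : ι → ℝ) : ∑ k, winProb u k = 1 := by
  have hdisj : Pairwise (Function.onFun Disjoint (winSet u)) := fun k l hkl =>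
    Set.disjoint_left.2 fun e hk hl => lt_asymm (hk l hkl.symm) (hl k hkl)
  have hties (k : ι) : (stdNormal ι).real
      {e | ∃ l, l ≠ k ∧ e l - e k ∈ Set.Icc (u k - u l) (u k - u l + 0)} = 0 :=
    le_antisymm ((stdNormal_exists_sub_mem_Icc_le k _ le_rfl).trans_eq (mul_zero _))
      measureReal_nonneg
  have hcover : Set.univ ⊆ (⋃ k, winSet u k) ∪
      ⋃ k, {e | ∃ l, l ≠ k ∧ e l - e k ∈ Set.Icc (u k - u l) (u k - u l + 0)} := by
    intro e _
    obtain ⟨k, hk⟩ := Finite.exists_max fun k => u k + e k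
    by_cases hwin : e ∈ winSet u k
    · exact Or.inl (Set.mem_iUnion.2 ⟨k, hwin⟩)
    · simp only [winSet, Set.mem_ofPred_eq, not_forall, not_lt] at hwin
      obtain ⟨l, hl, hle⟩ := hwin
      have hmax := hk l
      exact Or.inr (Set.mem_iUnion.2 ⟨k, l, hl, by linarith, by linarith⟩)
  have hunion : ∑ k, winProb u k = (stdNormal ι).real (⋃ k, winSet u k) :=
    (measureReal_iUnion_fintype hdisj (measurableSet_winSet u)).symm
  refine le_antisymm (hunion.trans_le measureReal_le_one) ?_
  calc (1 : ℝ) = (stdNormal ι).real Set.univ := probReal_univ.symm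
    _ ≤ _ := (measureReal_mono hcover).trans (measureReal_union_le _ _)
    _ ≤ ∑ k, winProb u k + 0 := by
        gcongr
        · exact hunion.ge
        · exact (measureReal_iUnion_fintype_le _).trans_eq (Finset.sum_eq_zero fun k _ => hties k)
    _ = ∑ k, winProb u k := add_zero _

lemma exists_pos_le_winProb (ι : Type*) [Fintype ι] (R : ℝ) :
    ∃ c > 0, ∀ u : ι → ℝ, (∀ l, |u l| ≤ R) → ∀ k, c ≤ winProb u k := by
  classical
  have hpos {s : Set ℝ} (hs : volume s ≠ 0) : 0 < (gaussianReal 0 1).real s :=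
    ENNReal.toReal_pos (fun h => hs (gaussianReal_absolutelyContinuous' 0 one_ne_zero h))
      (measure_ne_top _ _)
  set c := min ((gaussianReal 0 1).real (Set.Ioi (2 * R))) ((gaussianReal 0 1).real (Set.Iio 0))
  have hc : 0 < c := lt_min (hpos (by simp)) (hpos (by simp))
  refine ⟨c ^ Fintype.card ι, pow_pos hc _, fun u hu k => ?_⟩
  let box (l : ι) : Set ℝ := if l = k then Set.Ioi (2 * R) else Set.Iio 0
  have hbox : Set.univ.pi box ⊆ winSet u k := by
    intro e he l hl
    have hel : e l < 0 := by simpa [box, hl] using he l trivial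
    have hek : 2 * R < e k := by simpa [box] using he k trivial
    linarith [abs_le.1 (hu l), abs_le.1 (hu k)]
  calc c ^ Fintype.card ι = ∏ _l : ι, c := by rw [Finset.prod_const, Finset.card_univ]
    _ ≤ ∏ l, (gaussianReal 0 1).real (box l) := by
        refine Finset.prod_le_prod (fun _ _ => hc.le) fun l _ => ?_
        by_cases hl : l = k
        · simpa only [box, hl, if_true] using min_le_left _ _
        · simpa only [box, hl, if_false] using min_le_right _ _
    _ = (stdNormal ι).real (Set.univ.pi box) := by
        simp only [measureReal_def, Measure.pi_pi, ENNReal.toReal_prod]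
    _ ≤ winProb u k := measureReal_mono hbox

lemma winProb_pos (u : ι → ℝ) (k : ι) : 0 < winProb u k := by
  obtain ⟨c, hc, hle⟩ := exists_pos_le_winProb ι (∑ l, |u l|)
  exact hc.trans_le (hle u (fun l => Finset.single_le_sum (f := fun l => |u l|)
    (fun _ _ => abs_nonneg _) (Finset.mem_univ l)) k)

end RandomUtility

/-! ### The linear predictor -/

/-- The coefficient functions whose linear predictor is defined at every `L¹` curve. -/
abbrev BddCoef (β : ℝ → ℝ) : Prop := MemLp β ⊤ (volume.restrict (Set.Icc (0 : ℝ) 1))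

lemma ae_restrict_Icc {p : ℝ → Prop} (h : ∀ t ∈ Set.Icc (0 : ℝ) 1, p t) :
    ∀ᵐ t ∂volume.restrict (Set.Icc (0 : ℝ) 1), p t :=
  (ae_restrict_iff' measurableSet_Icc).2 (ae_of_all _ h)

lemma abs_linPred_le {β : ℝ → ℝ} {B : ℝ}
    (h : ∀ᵐ t ∂volume.restrict (Set.Icc (0 : ℝ) 1), |β t| ≤ B) (x : Curve) :
    |linPred β x| ≤ B * ‖x‖ := by
  rw [L1.norm_eq_integral_norm, ← integral_const_mul, linPred, ← Real.norm_eq_abs]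
  refine norm_integral_le_of_norm_le ((L1.integrable_coeFn x).norm.const_mul B) ?_
  filter_upwards [h] with t ht
  rw [norm_mul]
  exact mul_le_mul_of_nonneg_right ht (norm_nonneg _)

lemma BddCoef.exists_abs_linPred_le {β : ℝ → ℝ} (h : BddCoef β) :
    ∃ B : NNReal, ∀ x, |linPred β x| ≤ B * ‖x‖ := by
  refine ⟨⟨lpNorm β ⊤ (volume.restrict (Set.Icc (0 : ℝ) 1)), lpNorm_nonneg⟩, fun x => ?_⟩
  exact abs_linPred_le (ae_le_lpNorm_exponent_top h) x

lemma BddCoef.integrable_mul {β : ℝ → ℝ} (h : BddCoef β) (x : Curve) :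
    Integrable (fun t => β t * x t) (volume.restrict (Set.Icc (0 : ℝ) 1)) :=
  (L1.integrable_coeFn x).bdd_mul h.1 (ae_le_lpNorm_exponent_top h)

lemma linPred_sub_left {β β' : ℝ → ℝ} (h : BddCoef β) (h' : BddCoef β') (x : Curve) :
    linPred (fun t => β t - β' t) x = linPred β x - linPred β' x := by
  simp only [linPred, sub_mul]
  exact integral_sub (h.integrable_mul x) (h'.integrable_mul x)

lemma linPred_sub_right {β : ℝ → ℝ} (h : BddCoef β) (x y : Curve) :
    linPred β (x - y) = linPred β x - linPred β y := by
  simp only [linPred]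
  rw [← integral_sub (h.integrable_mul x) (h.integrable_mul y)]
  refine integral_congr_ae ?_
  filter_upwards [Lp.coeFn_sub x y] with t ht
  rw [ht, Pi.sub_apply, mul_sub]

lemma BddCoef.continuous_linPred {β : ℝ → ℝ} (h : BddCoef β) : Continuous (linPred β) := by
  obtain ⟨B, hB⟩ := h.exists_abs_linPred_le
  refine (LipschitzWith.of_dist_le_mul (K := B) fun x y => ?_).continuous
  rw [Real.dist_eq, dist_eq_norm, ← linPred_sub_right h]
  exact hB (x - y)

section Basis

variable {ψ : (J : ℕ) → Fin J → ℝ → ℝ} {K₀ : ℝ}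

lemma bddCoef_series {J : ℕ} (hψ : ∀ j, BddCoef (ψ J j)) (θ : Fin J → ℝ) :
    BddCoef (series ψ θ) :=
  memLp_finsetSum _ fun j _ => (hψ j).const_mul (θ j)

lemma linPred_series {J : ℕ} (hψ : ∀ j, BddCoef (ψ J j)) (θ : Fin J → ℝ) (x : Curve) :
    linPred (series ψ θ) x = ∑ j, θ j * linPred (ψ J j) x := by
  simp only [linPred, series, Finset.sum_mul, mul_assoc]
  rw [integral_finsetSum _ fun j _ => ((hψ j).integrable_mul x).const_mul _]
  exact Finset.sum_congr rfl fun j _ => integral_const_mul _ _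

lemma BasisStable.bddCoef_basis (h : BasisStable ψ K₀) (hψ : ∀ J j, Measurable (ψ J j)) (J : ℕ)
    (j : Fin J) : BddCoef (ψ J j) := by
  obtain ⟨C, -, hC⟩ := h
  have hseries (t : ℝ) : series ψ (Pi.single j (1 : ℝ)) t = ψ J j t := by
    simp [series, Pi.single_apply]
  refine memLp_top_of_bound (hψ J j).aestronglyMeasurable
    (C * (J : ℝ) ^ K₀ * √(∑ i, (Pi.single j (1 : ℝ) : Fin J → ℝ) i ^ 2))
    (ae_restrict_Icc fun t ht => ?_)
  simpa [← hseries, series] using hC J j.pos (Pi.single j 1) 0 t ht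

lemma BasisStable.exists_abs_series_sub_le (h : BasisStable ψ K₀) :
    ∃ C > 0, ∀ (J : ℕ) (θ θ' : Fin J → ℝ) (m : ℝ), 0 ≤ m → (∀ j, |θ j - θ' j| ≤ m) →
      ∀ t ∈ Set.Icc (0 : ℝ) 1, |series ψ θ t - series ψ θ' t| ≤ C * (J : ℝ) ^ K₀ * (J * m) := by
  obtain ⟨C, hC, hstable⟩ := h
  refine ⟨C, hC, fun J θ θ' m hm hθ t ht => ?_⟩
  rcases Nat.eq_zero_or_pos J with rfl | hJ
  · simp [series]
  have hJ' : (1 : ℝ) ≤ J := Nat.one_le_cast.2 hJ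
  refine (hstable J hJ θ θ' t ht).trans ?_
  gcongr
  rw [Real.sqrt_le_left (by positivity)]
  calc ∑ j, (θ j - θ' j) ^ 2 ≤ ∑ _j : Fin J, m ^ 2 :=
        Finset.sum_le_sum fun j _ => sq_le_sq.2 ((hθ j).trans (le_abs_self m))
    _ = J * m ^ 2 := by simp
    _ ≤ (J * m) ^ 2 := by rw [mul_pow]; gcongr; exact le_self_pow₀ hJ' two_ne_zero

lemma BasisApprox.bddCoef {β : ℝ → ℝ} {α H : ℝ} (hα : 0 < α) (h : BasisApprox ψ β α H)
    (hψ : ∀ J j, BddCoef (ψ J j)) : BddCoef β := by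
  obtain ⟨D, -, hD⟩ := h
  choose θ _ hθ using fun n : ℕ => hD (n + 1) (Nat.le_add_left 1 n)
  have hlim : Tendsto (fun n : ℕ => D * ((n + 1 : ℕ) : ℝ) ^ (-α)) atTop (𝓝 0) := by
    simpa using ((tendsto_rpow_neg_atTop hα).comp
      (tendsto_natCast_atTop_atTop.comp (tendsto_add_atTop_nat 1))).const_mul D
  have hmeas : AEStronglyMeasurable β (volume.restrict (Set.Icc (0 : ℝ) 1)) :=
    aestronglyMeasurable_of_tendsto_ae atTop (fun n => (bddCoef_series (hψ _) (θ n)).1)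
      (ae_restrict_Icc fun t ht => tendsto_iff_dist_tendsto_zero.2
        (squeeze_zero (fun _ => dist_nonneg)
          (fun n => (dist_comm _ _).trans_le (hθ n t ht)) hlim))
  have hsub : BddCoef (β - series ψ (θ 0)) :=
    memLp_top_of_bound (hmeas.sub (bddCoef_series (hψ _) _).1) _ (ae_restrict_Icc (hθ 0))
  simpa only [sub_add_cancel] using hsub.add (bddCoef_series (hψ _) (θ 0))

end Basis

/-! ### The category probabilities -/

section CatProb

variable {q : ℕ}

/-- The utilities of the `q + 1` categories at the curve `x`, the last category being the
reference category with utility `0`. -/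
def catUtility (β : Fin q → ℝ → ℝ) (x : Curve) : Fin (q + 1) → ℝ :=
  Fin.snoc (α := fun _ => ℝ) (fun l => linPred (β l) x) 0

lemma selects_sub_iff_mem_winSet (β : Fin q → ℝ → ℝ) (x : Curve) (e : Fin (q + 1) → ℝ)
    (k : Fin (q + 1)) :
    Selects (fun l => linPred (β l) x + (e l.castSucc - e (Fin.last q))) k ↔
      e ∈ winSet (catUtility β x) k := by
  induction k using Fin.lastCases with
  | last =>
    simp only [Selects, Fin.lastCases_last, winSet, Set.mem_ofPred_eq, catUtility, Fin.snoc_last,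
      zero_add, Fin.forall_fin_succ', ne_eq, not_true_eq_false, false_imp_iff, and_true,
      Fin.snoc_castSucc, Fin.castSucc_ne_last, not_false_eq_true, forall_const]
    refine forall_congr' fun l => ?_
    rw [← add_sub_assoc, sub_neg]
  | cast i =>
    simp only [Selects, Fin.lastCases_castSucc, winSet, Set.mem_ofPred_eq, catUtility,
      Fin.forall_fin_succ', ne_eq, Fin.snoc_castSucc, Fin.snoc_last, zero_add,
      (Fin.castSucc_ne_last i).symm, not_false_eq_true, forall_const, Fin.castSucc_inj]
    refine and_congr (forall₂_congr fun l _ => ?_) ?_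
    · rw [← add_sub_assoc, ← add_sub_assoc, sub_lt_sub_iff_right]
    · rw [← add_sub_assoc, sub_pos]

lemma measurableSet_selects (a : Fin q → ℝ) (k : Fin (q + 1)) :
    MeasurableSet {e : Fin q → ℝ | Selects (fun l => a l + e l) k} := by
  induction k using Fin.lastCases with
  | last =>
    simp only [Selects, Fin.lastCases_last, Set.ofPred_forall]
    exact .iInter fun l => measurableSet_lt (by fun_prop) (by fun_prop)
  | cast i =>
    simp only [Selects, Fin.lastCases_castSucc, Set.ofPred_and, Set.ofPred_forall]
    exact (MeasurableSet.iInter fun l => .iInter fun _ =>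
      measurableSet_lt (by fun_prop) (by fun_prop)).inter
        (measurableSet_lt (by fun_prop) (by fun_prop))

lemma catProb_eq_winProb (β : Fin q → ℝ → ℝ) (x : Curve) (k : Fin (q + 1)) :
    catProb β x k = winProb (catUtility β x) k := by
  rw [catProb, latentNoise, map_measureReal_apply (by fun_prop) (measurableSet_selects _ k)]
  congr 1
  ext e
  exact selects_sub_iff_mem_winSet β x e k

lemma catProb_nonneg (β : Fin q → ℝ → ℝ) (x : Curve) (k : Fin (q + 1)) : 0 ≤ catProb β x k :=
  measureReal_nonneg

lemma catProb_pos (β : Fin q → ℝ → ℝ) (x : Curve) (k : Fin (q + 1)) : 0 < catProb β x k :=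
  (winProb_pos _ k).trans_eq (catProb_eq_winProb β x k).symm

lemma sum_catProb (β : Fin q → ℝ → ℝ) (x : Curve) : ∑ k, catProb β x k = 1 := by
  simp only [catProb_eq_winProb, sum_winProb]

lemma catProb_le_one (β : Fin q → ℝ → ℝ) (x : Curve) (k : Fin (q + 1)) : catProb β x k ≤ 1 :=
  (Finset.single_le_sum (fun k _ => catProb_nonneg β x k) (Finset.mem_univ k)).trans_eq
    (sum_catProb β x)

lemma abs_catProb_sub_le {β β' : Fin q → ℝ → ℝ} {d R : ℝ} (hd : 0 ≤ d)
    (hβ : ∀ l, BddCoef (β l)) (hβ' : ∀ l, BddCoef (β' l))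
    (hclose : ∀ l, ∀ t ∈ Set.Icc (0 : ℝ) 1, |β l t - β' l t| ≤ d) {x : Curve} (hx : ‖x‖ ≤ R)
    (k : Fin (q + 1)) : |catProb β x k - catProb β' x k| ≤ 2 * (q + 1) * R * d := by
  have hR : 0 ≤ R := (norm_nonneg x).trans hx
  have hutil (l : Fin (q + 1)) : |catUtility β x l - catUtility β' x l| ≤ d * R := by
    induction l using Fin.lastCases with
    | last => simpa [catUtility] using mul_nonneg hd hR
    | cast l =>
      simp only [catUtility, Fin.snoc_castSucc, ← linPred_sub_left (hβ l) (hβ' l)]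
      exact (abs_linPred_le (ae_restrict_Icc (hclose l)) x).trans (by gcongr)
  calc |catProb β x k - catProb β' x k|
      ≤ 2 * Fintype.card (Fin (q + 1)) * (d * R) := by
        simpa only [catProb_eq_winProb] using abs_winProb_sub_le (by positivity) hutil k
    _ = 2 * (q + 1) * R * d := by rw [Fintype.card_fin]; push_cast; ring

lemma exists_pos_le_catProb {β : Fin q → ℝ → ℝ} (hβ : ∀ l, BddCoef (β l)) (R : ℝ) :
    ∃ c > 0, ∀ x : Curve, ‖x‖ ≤ R → ∀ k, c ≤ catProb β x k := by
  choose B hB using fun l => (hβ l).exists_abs_linPred_le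
  obtain ⟨c, hc, hle⟩ := exists_pos_le_winProb (Fin (q + 1)) ((∑ l, (B l : ℝ)) * R)
  refine ⟨c, hc, fun x hx k => ?_⟩
  rw [catProb_eq_winProb]
  have hR : 0 ≤ R := (norm_nonneg x).trans hx
  refine hle _ (fun l => ?_) k
  induction l using Fin.lastCases with
  | last => simpa [catUtility] using by positivity
  | cast l =>
    rw [catUtility, Fin.snoc_castSucc]
    refine (hB l x).trans ?_
    gcongr
    exact Finset.single_le_sum (f := fun l => (B l : ℝ)) (fun _ _ => NNReal.coe_nonneg _)
      (Finset.mem_univ l)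

lemma measurable_catProb_comp {Ω : Type*} [MeasurableSpace Ω] {β : Ω → Fin q → ℝ → ℝ}
    {X : Ω → Curve} {Y : Ω → Fin (q + 1)}
    (hβ : ∀ l, Measurable fun ω => linPred (β ω l) (X ω)) (hY : Measurable Y) :
    Measurable fun ω => catProb (β ω) (X ω) (Y ω) := by
  have hwin : Measurable fun z : (Fin (q + 1) → ℝ) × Fin (q + 1) => winProb z.1 z.2 :=
    measurable_from_prod_countable_left fun k => (continuous_winProb k).measurable
  have hutil : Measurable fun ω => catUtility (β ω) (X ω) := by
    refine measurable_pi_lambda _ fun l => ?_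
    induction l using Fin.lastCases with
    | last => simpa only [catUtility, Fin.snoc_last] using measurable_const
    | cast l => simpa only [catUtility, Fin.snoc_castSucc] using hβ l
  simpa only [catProb_eq_winProb] using! hwin.comp (hutil.prodMk hY)

lemma measurable_catProb {β : Fin q → ℝ → ℝ} (hβ : ∀ l, BddCoef (β l)) :
    Measurable fun z : Curve × Fin (q + 1) => catProb β z.1 z.2 :=
  measurable_catProb_comp (fun l => (hβ l).continuous_linPred.measurable.comp measurable_fst)
    measurable_snd

lemma measurableEmbedding_sigmaMk {ι : Type*} {Ω : ι → Type*} [∀ i, MeasurableSpace (Ω i)]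
    (i : ι) : MeasurableEmbedding (Sigma.mk (β := Ω) i) where
  injective := sigma_mk_injective
  measurable := fun _ hs => MeasurableSpace.measurableSet_iInf.1 hs i
  measurableSet_image' := by
    refine fun s hs => MeasurableSpace.measurableSet_iInf.2 fun j => ?_
    change MeasurableSet (Sigma.mk j ⁻¹' (Sigma.mk i '' s))
    rcases eq_or_ne i j with rfl | hij
    · rwa [Set.preimage_image_eq s sigma_mk_injective]
    · rw [Set.preimage_image_sigmaMk_of_ne hij.symm]
      exact MeasurableSet.empty

lemma measurable_from_sigma_prod {ι : Type*} [Countable ι] {Ω : ι → Type*}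
    [∀ i, MeasurableSpace (Ω i)] {α δ : Type*} [MeasurableSpace α] [MeasurableSpace δ]
    {f : (Σ i, Ω i) × α → δ} (hf : ∀ i, Measurable fun z : Ω i × α => f (⟨i, z.1⟩, z.2)) :
    Measurable f := by
  intro s hs
  have hunion : f ⁻¹' s = ⋃ i, Prod.map (Sigma.mk i) id ''
      ((fun z : Ω i × α => f (⟨i, z.1⟩, z.2)) ⁻¹' s) := by
    ext z
    simp only [Set.mem_preimage, Set.mem_iUnion, Set.mem_image]
    constructor
    · exact fun h => ⟨z.1.1, (z.1.2, z.2), h, rfl⟩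
    · rintro ⟨i, z, h, rfl⟩
      exact h
  rw [hunion]
  exact .iUnion fun i => ((measurableEmbedding_sigmaMk i).prodMap .id).measurableSet_image'
    (hf i hs)

lemma measurable_catProb_coefFun {ψ : (J : ℕ) → Fin J → ℝ → ℝ} (hψ : ∀ J j, BddCoef (ψ J j)) :
    Measurable fun z : Param q × (Curve × Fin (q + 1)) =>
      catProb (coefFun ψ z.1) z.2.1 z.2.2 := by
  refine measurable_from_sigma_prod fun J => measurable_catProb_comp (fun l => ?_)
    (measurable_snd.comp measurable_snd)
  simp only [coefFun, linPred_series (hψ J)]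
  exact Finset.measurable_fun_sum _ fun j _ => Measurable.mul (by fun_prop)
    ((hψ J j).continuous_linPred.measurable.comp (measurable_fst.comp measurable_snd))

end CatProb

/-! ### Posteriors of abstract likelihood ratios -/

section LikelihoodRatio

variable {Z T : Type*} [MeasurableSpace Z] {n : ℕ}

/-- The law of `n` independent observations with law `P`. -/
abbrev iidLaw (P : Measure Z) (n : ℕ) : Measure (Fin n → Z) := Measure.pi fun _ => P

lemma ofReal_exp_mul_ofReal_exp (x y : ℝ) :
    ENNReal.ofReal (exp x) * ENNReal.ofReal (exp y) = ENNReal.ofReal (exp (x + y)) := by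
  rw [← ENNReal.ofReal_mul (Real.exp_pos x).le, Real.exp_add]

lemma div_ofReal_exp (u : ℝ≥0∞) (x : ℝ) :
    u / ENNReal.ofReal (exp x) = u * ENNReal.ofReal (exp (-x)) := by
  rw [div_eq_mul_inv, Real.exp_neg, ENNReal.ofReal_inv_of_pos (Real.exp_pos x)]

variable {P : Measure Z} [IsProbabilityMeasure P]

lemma lintegral_iidLaw_prod {g : Z → ℝ≥0∞} (hg : Measurable g) :
    ∫⁻ D, ∏ i, g (D i) ∂iidLaw P n = (∫⁻ z, g z ∂P) ^ n := by
  have heval (i : Fin n) : ∫⁻ D, g (D i) ∂iidLaw P n = ∫⁻ z, g z ∂P :=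
    (measurePreserving_eval (fun _ : Fin n => P) i).lintegral_comp hg
  rw [lintegral_prod_eq_prod_lintegral_of_indepFun Finset.univ _
    (iIndepFun_pi (X := fun _ => g) fun _ => hg.aemeasurable)
    (fun i => hg.comp (measurable_pi_apply i))]
  simp only [heval, Finset.prod_const, Finset.card_univ, Fintype.card_fin]

variable {r : T → Z → ℝ≥0∞}

lemma measure_exists_lt_prod_le {S : Set T} {w : Z → ℝ≥0∞} (hw : Measurable w) {s : ℝ}
    (hws : ∫⁻ z, w z ∂P ≤ ENNReal.ofReal (exp s)) (hrw : ∀ᵐ z ∂P, ∀ θ ∈ S, r θ z ≤ w z ^ 2)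
    (b : ℝ) :
    iidLaw P n {D | ∃ θ ∈ S, ENNReal.ofReal (exp (-b)) < ∏ i, r θ (D i)} ≤
      ENNReal.ofReal (exp (b / 2 + n * s)) := by
  have hdom : ∀ᵐ D ∂iidLaw P n, ∀ i, ∀ θ ∈ S, r θ (D i) ≤ w (D i) ^ 2 :=
    ae_all_iff.2 fun i => (Measure.quasiMeasurePreserving_eval (fun _ : Fin n => P) i).ae hrw
  have hsub : {D | ∃ θ ∈ S, ENNReal.ofReal (exp (-b)) < ∏ i, r θ (D i)} ≤ᵐ[iidLaw P n]
      {D | ENNReal.ofReal (exp (-(b / 2))) ≤ ∏ i, w (D i)} := by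
    filter_upwards [hdom] with D hD ⟨θ, hθ, hlt⟩
    refine (ENNReal.pow_le_pow_left_iff two_ne_zero).1 ?_
    calc ENNReal.ofReal (exp (-(b / 2))) ^ 2 = ENNReal.ofReal (exp (-b)) := by
          rw [sq, ofReal_exp_mul_ofReal_exp]; ring_nf
      _ ≤ ∏ i, r θ (D i) := hlt.le
      _ ≤ ∏ i, w (D i) ^ 2 := Finset.prod_le_prod' fun i _ => hD i θ hθ
      _ = (∏ i, w (D i)) ^ 2 := Finset.prod_pow _ _ _
  have hmeas : Measurable fun D : Fin n → Z => ∏ i, w (D i) :=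
    Finset.measurable_fun_prod _ fun i _ => hw.comp (measurable_pi_apply i)
  calc iidLaw P n {D | ∃ θ ∈ S, ENNReal.ofReal (exp (-b)) < ∏ i, r θ (D i)}
      ≤ (∫⁻ z, w z ∂P) ^ n / ENNReal.ofReal (exp (-(b / 2))) := by
        rw [← lintegral_iidLaw_prod hw]
        exact (measure_mono_ae hsub).trans (meas_ge_le_lintegral_div hmeas.aemeasurable
          (ENNReal.ofReal_pos.2 (Real.exp_pos _)).ne' ENNReal.ofReal_ne_top)
    _ ≤ ENNReal.ofReal (exp s) ^ n / ENNReal.ofReal (exp (-(b / 2))) := by gcongr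
    _ = ENNReal.ofReal (exp (b / 2 + n * s)) := by
        rw [← ENNReal.ofReal_pow (Real.exp_pos s).le, ← Real.exp_nat_mul, div_ofReal_exp,
          ofReal_exp_mul_ofReal_exp]
        ring_nf

lemma measure_exists_mem_iUnion_lt_prod_le {κ : Type*} [Fintype κ] {S : κ → Set T} {s : ℝ}
    (h : ∀ k, ∃ w : Z → ℝ≥0∞, Measurable w ∧ ∫⁻ z, w z ∂P ≤ ENNReal.ofReal (exp s) ∧
      ∀ᵐ z ∂P, ∀ θ ∈ S k, r θ z ≤ w z ^ 2) (b : ℝ) :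
    iidLaw P n {D | ∃ θ ∈ ⋃ k, S k, ENNReal.ofReal (exp (-b)) < ∏ i, r θ (D i)} ≤
      Fintype.card κ * ENNReal.ofReal (exp (b / 2 + n * s)) := by
  have hunion : {D : Fin n → Z | ∃ θ ∈ ⋃ k, S k, ENNReal.ofReal (exp (-b)) < ∏ i, r θ (D i)} =
      ⋃ k, {D | ∃ θ ∈ S k, ENNReal.ofReal (exp (-b)) < ∏ i, r θ (D i)} := by
    ext D
    simp only [Set.mem_iUnion, Set.mem_ofPred_eq]
    exact ⟨fun ⟨θ, ⟨k, hk⟩, hlt⟩ => ⟨k, θ, hk, hlt⟩, fun ⟨k, θ, hk, hlt⟩ => ⟨θ, ⟨k, hk⟩, hlt⟩⟩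
  rw [hunion]
  calc _ ≤ ∑ k, iidLaw P n {D | ∃ θ ∈ S k, ENNReal.ofReal (exp (-b)) < ∏ i, r θ (D i)} :=
        measure_iUnion_fintype_le _ _
    _ ≤ ∑ _k : κ, ENNReal.ofReal (exp (b / 2 + n * s)) := by
        refine Finset.sum_le_sum fun k _ => ?_
        obtain ⟨w, hw, hws, hrw⟩ := h k
        exact measure_exists_lt_prod_le hw hws hrw b
    _ = _ := by rw [Finset.sum_const, Finset.card_univ, nsmul_eq_mul]

variable [MeasurableSpace T] {Q : Measure T}

lemma sq_measure_univ_le {ν : Measure T} {f : T → ℝ≥0∞} (hf : Measurable f)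
    (h0 : ∀ θ, f θ ≠ 0) (h1 : ∀ θ, f θ ≠ ∞) :
    ν Set.univ ^ 2 ≤ (∫⁻ θ, f θ ∂ν) * ∫⁻ θ, (f θ)⁻¹ ∂ν := by
  have hholder := ENNReal.lintegral_mul_norm_pow_le (μ := ν) hf.aemeasurable hf.inv.aemeasurable
    (p := 1 / 2) (q := 1 / 2) (by norm_num) (by norm_num) (by norm_num)
  simp only [← ENNReal.mul_rpow_of_nonneg _ _ one_half_pos.le, Pi.inv_apply,
    ENNReal.mul_inv_cancel (h0 _) (h1 _), ENNReal.one_rpow, lintegral_one] at hholder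
  calc ν Set.univ ^ 2
      ≤ (((∫⁻ θ, f θ ∂ν) * ∫⁻ θ, (f θ)⁻¹ ∂ν) ^ (1 / 2 : ℝ)) ^ 2 := by gcongr
    _ = (∫⁻ θ, f θ ∂ν) * ∫⁻ θ, (f θ)⁻¹ ∂ν := by
        rw [← ENNReal.rpow_mul_natCast]
        norm_num

lemma lintegral_div_lintegral_le {ν : Measure T} [IsProbabilityMeasure ν] {f : T → ℝ≥0∞}
    {B F : Set T} {a b c : ℝ} (hF : MeasurableSet F)
    (ha : ENNReal.ofReal (exp (-a)) ≤ ∫⁻ θ, f θ ∂ν)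
    (hb : ∀ θ ∈ B ∩ F, f θ ≤ ENNReal.ofReal (exp (-b)))
    (hc : ∫⁻ θ in Fᶜ, f θ ∂ν ≤ ENNReal.ofReal (exp (-c))) :
    (∫⁻ θ in B, f θ ∂ν) / ∫⁻ θ, f θ ∂ν ≤
      ENNReal.ofReal (exp (a - b)) + ENNReal.ofReal (exp (a - c)) := by
  have hBF : ∫⁻ θ in B ∩ F, f θ ∂ν ≤ ENNReal.ofReal (exp (-b)) :=
    calc ∫⁻ θ in B ∩ F, f θ ∂ν ≤ ∫⁻ _ in B ∩ F, ENNReal.ofReal (exp (-b)) ∂ν :=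
          setLIntegral_mono measurable_const hb
      _ ≤ ENNReal.ofReal (exp (-b)) := by
          rw [setLIntegral_const]
          exact mul_le_of_le_one_right' prob_le_one
  have hBF' : ∫⁻ θ in B \ F, f θ ∂ν ≤ ENNReal.ofReal (exp (-c)) :=
    (lintegral_mono_set (Set.sdiff_subset_compl B F)).trans hc
  calc (∫⁻ θ in B, f θ ∂ν) / ∫⁻ θ, f θ ∂ν
      ≤ (ENNReal.ofReal (exp (-b)) + ENNReal.ofReal (exp (-c))) /
          ENNReal.ofReal (exp (-a)) := by
        rw [← lintegral_inter_add_sdiff f B hF]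
        gcongr
    _ = ENNReal.ofReal (exp (a - b)) + ENNReal.ofReal (exp (a - c)) := by
        rw [div_ofReal_exp, add_mul, ofReal_exp_mul_ofReal_exp, ofReal_exp_mul_ofReal_exp]
        ring_nf

lemma measurable_prod_of_uncurry (hr : Measurable (Function.uncurry r)) :
    Measurable fun z : (Fin n → Z) × T => ∏ i, r z.2 (z.1 i) :=
  Finset.measurable_fun_prod _ fun i _ =>
    hr.comp (measurable_snd.prodMk ((measurable_pi_apply i).comp measurable_fst))

lemma measure_le_lintegral_prod_le [SFinite Q] (hr : Measurable (Function.uncurry r)) {s : ℝ}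
    (hs : ∀ᵐ θ ∂Q, ∫⁻ z, r θ z ∂P ≤ ENNReal.ofReal (exp s)) {x : ℝ≥0∞} (hx0 : x ≠ 0)
    (hx : x ≠ ∞) :
    iidLaw P n {D | x ≤ ∫⁻ θ, ∏ i, r θ (D i) ∂Q} ≤
      ENNReal.ofReal (exp (n * s)) * Q Set.univ / x := by
  have hmeas : Measurable fun D : Fin n → Z => ∫⁻ θ, ∏ i, r θ (D i) ∂Q :=
    (measurable_prod_of_uncurry hr).lintegral_prod_right'
  have hmean : ∫⁻ D, ∫⁻ θ, ∏ i, r θ (D i) ∂Q ∂iidLaw P n ≤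
      ENNReal.ofReal (exp (n * s)) * Q Set.univ :=
    calc ∫⁻ D, ∫⁻ θ, ∏ i, r θ (D i) ∂Q ∂iidLaw P n
        = ∫⁻ θ, (∫⁻ z, r θ z ∂P) ^ n ∂Q := by
          rw [lintegral_lintegral_swap (measurable_prod_of_uncurry hr).aemeasurable]
          exact lintegral_congr fun θ => lintegral_iidLaw_prod (hr.comp measurable_prodMk_left)
      _ ≤ ∫⁻ _, ENNReal.ofReal (exp (n * s)) ∂Q := by
          refine lintegral_mono_ae (hs.mono fun θ hθ => ?_)
          rw [Real.exp_nat_mul, ENNReal.ofReal_pow (Real.exp_pos s).le]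
          gcongr
      _ = ENNReal.ofReal (exp (n * s)) * Q Set.univ := lintegral_const _
  exact (meas_ge_le_lintegral_div hmeas.aemeasurable hx0 hx).trans (by gcongr)

lemma measure_lintegral_prod_lt_le [IsFiniteMeasure Q] (hr : Measurable (Function.uncurry r))
    (hr0 : ∀ θ z, r θ z ≠ 0) (hr1 : ∀ θ z, r θ z ≠ ∞) {U : Set T} (hU : MeasurableSet U) {s : ℝ}
    (hs : ∀ θ ∈ U, ∫⁻ z, (r θ z)⁻¹ ∂P ≤ ENNReal.ofReal (exp s)) (t : ℝ) :
    iidLaw P n {D | ∫⁻ θ, ∏ i, r θ (D i) ∂Q < ENNReal.ofReal (exp (-t)) * Q U} ≤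
      ENNReal.ofReal (exp (n * s - t)) := by
  rcases eq_or_ne (Q U) 0 with hU0 | hU0
  · simp [hU0]
  have hexp : ENNReal.ofReal (exp t) ≠ 0 := (ENNReal.ofReal_pos.2 (Real.exp_pos t)).ne'
  have hsub : {D : Fin n → Z | ∫⁻ θ, ∏ i, r θ (D i) ∂Q < ENNReal.ofReal (exp (-t)) * Q U} ⊆
      {D | ENNReal.ofReal (exp t) * Q U ≤ ∫⁻ θ in U, ∏ i, (r θ (D i))⁻¹ ∂Q} := by
    intro D hD
    have hinv (θ : T) : ∏ i, (r θ (D i))⁻¹ = (∏ i, r θ (D i))⁻¹ :=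
      (ENNReal.prod_inv_distrib fun i _ j _ _ => Or.inl (hr0 θ _)).symm
    have hCS := sq_measure_univ_le (ν := Q.restrict U) (f := fun θ => ∏ i, r θ (D i))
      (Finset.measurable_fun_prod _ fun i _ => hr.of_uncurry_right)
      (fun θ => Finset.prod_ne_zero_iff.2 fun i _ => hr0 θ _)
      (fun θ => ENNReal.prod_ne_top fun i _ => hr1 θ _)
    simp only [Measure.restrict_apply_univ, ← hinv] at hCS
    refine (ENNReal.mul_le_mul_iff_right (mul_ne_zero
      (ENNReal.ofReal_pos.2 (Real.exp_pos (-t))).ne' hU0)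
      (ENNReal.mul_ne_top ENNReal.ofReal_ne_top (measure_ne_top Q U))).1 ?_
    calc ENNReal.ofReal (exp (-t)) * Q U * (ENNReal.ofReal (exp t) * Q U) = Q U ^ 2 := by
          rw [mul_mul_mul_comm, ofReal_exp_mul_ofReal_exp, neg_add_cancel, Real.exp_zero,
            ENNReal.ofReal_one, one_mul, sq]
      _ ≤ (∫⁻ θ, ∏ i, r θ (D i) ∂Q) * ∫⁻ θ in U, ∏ i, (r θ (D i))⁻¹ ∂Q :=
          hCS.trans (by gcongr; exact Measure.restrict_le_self)
      _ ≤ _ := by gcongr; exact hD.le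
  refine (measure_mono hsub).trans ((measure_le_lintegral_prod_le (Q := Q.restrict U) hr.inv
    ((ae_restrict_iff' hU).2 (ae_of_all _ hs)) (mul_ne_zero hexp hU0)
    (ENNReal.mul_ne_top ENNReal.ofReal_ne_top (measure_ne_top Q U))).trans_eq ?_)
  rw [Measure.restrict_apply_univ, ENNReal.mul_div_mul_right _ _ hU0 (measure_ne_top Q U),
    div_ofReal_exp, ofReal_exp_mul_ofReal_exp, sub_eq_add_neg]

lemma measure_le_posterior_le [IsProbabilityMeasure Q] (hr : Measurable (Function.uncurry r))
    (hmean : ∀ θ, ∫⁻ z, r θ z ∂P ≤ 1) {B F : Set T} (hF : MeasurableSet F) {a b c : ℝ}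
    {u v x δ : ℝ≥0∞}
    (hu : iidLaw P n {D | ∫⁻ θ, ∏ i, r θ (D i) ∂Q < ENNReal.ofReal (exp (-a))} ≤ u)
    (hv : iidLaw P n {D | ∃ θ ∈ B ∩ F, ENNReal.ofReal (exp (-b)) < ∏ i, r θ (D i)} ≤ v)
    (hx : Q Fᶜ ≤ x)
    (hδ : ENNReal.ofReal (exp (a - b)) + ENNReal.ofReal (exp (a - c)) < δ) :
    iidLaw P n {D | δ ≤ (∫⁻ θ in B, ∏ i, r θ (D i) ∂Q) / ∫⁻ θ, ∏ i, r θ (D i) ∂Q} ≤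
      u + v + x * ENNReal.ofReal (exp c) := by
  have hcompl : iidLaw P n {D | ENNReal.ofReal (exp (-c)) ≤ ∫⁻ θ in Fᶜ, ∏ i, r θ (D i) ∂Q} ≤
      x * ENNReal.ofReal (exp c) := by
    refine (measure_le_lintegral_prod_le hr (s := 0) (ae_of_all _ fun θ => ?_)
      (ENNReal.ofReal_pos.2 (Real.exp_pos _)).ne' ENNReal.ofReal_ne_top).trans ?_
    · simpa using hmean θ
    · rw [mul_zero, Real.exp_zero, ENNReal.ofReal_one, one_mul, Measure.restrict_apply_univ,
        div_ofReal_exp, neg_neg]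
      gcongr
  refine (measure_mono fun D hD => ?_).trans ((measure_union_le _ _).trans (add_le_add
    ((measure_union_le _ _).trans (add_le_add hu hv)) hcompl))
  by_contra! hnot
  simp only [Set.mem_union, Set.mem_ofPred_eq, not_or, not_lt, not_exists, not_and,
    not_le] at hnot
  exact (hδ.trans_le hD).not_ge
    (lintegral_div_lintegral_le hF hnot.1.1 hnot.1.2 hnot.2.le)

end LikelihoodRatio

/-! ### Discrepancies between probability vectors -/

section ProbVector

variable {κ : Type*} [Fintype κ] {p p₀ : κ → ℝ}

lemma sum_mul_inv_div_le (hp : ∑ k, p k = 1) (hp₀ : ∑ k, p₀ k = 1) (hp₀_pos : ∀ k, 0 < p₀ k)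
    {c d : ℝ} (hc : 0 < c) (hcp : ∀ k, c ≤ p k) (hd : ∀ k, |p k - p₀ k| ≤ d) :
    ∑ k, p₀ k * (p k / p₀ k)⁻¹ ≤ 1 + Fintype.card κ * (d ^ 2 / c) := by
  have hchi (k : κ) : p₀ k * (p k / p₀ k)⁻¹ ≤ 2 * p₀ k - p k + d ^ 2 / c := by
    have hpk : 0 < p k := hc.trans_le (hcp k)
    have := hp₀_pos k
    calc p₀ k * (p k / p₀ k)⁻¹ = 2 * p₀ k - p k + (p k - p₀ k) ^ 2 / p k := by
          field_simp
          ring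
      _ ≤ 2 * p₀ k - p k + d ^ 2 / c := by
          gcongr 2 * p₀ k - p k + ?_ / ?_
          · exact sq_le_sq.2 ((hd k).trans (le_abs_self d))
          · exact hcp k
  refine (Finset.sum_le_sum fun k _ => hchi k).trans_eq ?_
  rw [Finset.sum_add_distrib, Finset.sum_sub_distrib, ← Finset.mul_sum, hp, hp₀, Finset.sum_const,
    Finset.card_univ, nsmul_eq_mul]
  ring

lemma sqrt_mul_le_add_div_two_sub {a b : ℝ} (ha : 0 ≤ a) (ha1 : a ≤ 1) (hb : 0 ≤ b)
    (hb1 : b ≤ 1) : √(a * b) ≤ (a + b) / 2 - |a - b| ^ 2 / 8 := by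
  obtain ⟨x, hx, rfl⟩ : ∃ x, 0 ≤ x ∧ x ^ 2 = a := ⟨√a, Real.sqrt_nonneg a, Real.sq_sqrt ha⟩
  obtain ⟨y, hy, rfl⟩ : ∃ y, 0 ≤ y ∧ y ^ 2 = b := ⟨√b, Real.sqrt_nonneg b, Real.sq_sqrt hb⟩
  have hsum : (x + y) ^ 2 ≤ 4 := by
    have hx1 := (sq_le_one_iff₀ hx).1 ha1
    have hy1 := (sq_le_one_iff₀ hy).1 hb1
    nlinarith
  calc √(x ^ 2 * y ^ 2) = (x ^ 2 + y ^ 2) / 2 - (x - y) ^ 2 * 4 / 8 := by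
        rw [← mul_pow, Real.sqrt_sq (by positivity)]
        ring
    _ ≤ (x ^ 2 + y ^ 2) / 2 - (x - y) ^ 2 * (x + y) ^ 2 / 8 := by gcongr
    _ = (x ^ 2 + y ^ 2) / 2 - |x ^ 2 - y ^ 2| ^ 2 / 8 := by
        rw [sq_abs]
        ring

lemma mul_sqrt_div_le {a b δ : ℝ} (ha : 0 ≤ a) (ha1 : a ≤ 1) (hb : 0 < b) (hb1 : b ≤ 1)
    (hδ : 0 ≤ δ) : b * √((a + δ) / b) ≤ (a + b) / 2 - |a - b| ^ 2 / 8 + √δ :=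
  calc b * √((a + δ) / b) = √(a * b + δ * b) := by
        conv_lhs => rw [← Real.sqrt_sq hb.le, ← Real.sqrt_mul (sq_nonneg _), Real.sqrt_sq hb.le]
        congr 1
        field_simp
    _ ≤ √(a * b) + √(δ * b) := by
        have ha' := Real.sq_sqrt (mul_nonneg ha hb.le)
        have hδ' := Real.sq_sqrt (mul_nonneg hδ hb.le)
        refine Real.sqrt_le_iff.2 ⟨by positivity, ?_⟩
        nlinarith [mul_nonneg (Real.sqrt_nonneg (a * b)) (Real.sqrt_nonneg (δ * b))]
    _ ≤ (a + b) / 2 - |a - b| ^ 2 / 8 + √δ := by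
        gcongr
        · exact sqrt_mul_le_add_div_two_sub ha ha1 hb.le hb1
        · exact mul_le_of_le_one_right hδ hb1

lemma sum_mul_sqrt_div_le (hp : ∑ k, p k = 1) (hp₀ : ∑ k, p₀ k = 1) (hp_nonneg : ∀ k, 0 ≤ p k)
    (hp₀_pos : ∀ k, 0 < p₀ k) {δ : ℝ} (hδ : 0 ≤ δ) :
    ∑ k, p₀ k * √((p k + δ) / p₀ k) ≤
      1 + Fintype.card κ * √δ - (∑ k, |p k - p₀ k| ^ 2) / 8 := by
  have hp_le (k : κ) : p k ≤ 1 :=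
    (Finset.single_le_sum (fun k _ => hp_nonneg k) (Finset.mem_univ k)).trans_eq hp
  have hp₀_le (k : κ) : p₀ k ≤ 1 :=
    (Finset.single_le_sum (fun k _ => (hp₀_pos k).le) (Finset.mem_univ k)).trans_eq hp₀
  refine (Finset.sum_le_sum fun k _ =>
    mul_sqrt_div_le (hp_nonneg k) (hp_le k) (hp₀_pos k) (hp₀_le k) hδ).trans_eq ?_
  rw [Finset.sum_add_distrib, Finset.sum_sub_distrib, ← Finset.sum_div, ← Finset.sum_div,
    Finset.sum_add_distrib, hp, hp₀, Finset.sum_const, Finset.card_univ, nsmul_eq_mul]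
  ring

end ProbVector

/-! ### The likelihood ratio of the probit model -/

section LikRatio

variable {q : ℕ} {G : Measure Curve} {β β₀ : Fin q → ℝ → ℝ}

lemma lintegral_ofReal_obsLaw (h₀ : ∀ l, BddCoef (β₀ l))
    {g : Curve × Fin (q + 1) → ℝ} (hg : Measurable g) (hg0 : ∀ z, 0 ≤ g z) :
    ∫⁻ z, ENNReal.ofReal (g z) ∂obsLaw G β₀ =
      ∫⁻ x, ENNReal.ofReal (∑ k, catProb β₀ x k * g (x, k)) ∂G := by
  have hm := (measurable_catProb h₀).ennreal_ofReal
  rw [obsLaw, lintegral_withDensity_eq_lintegral_mul _ hm hg.ennreal_ofReal,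
    lintegral_prod _ (hm.mul hg.ennreal_ofReal).aemeasurable]
  refine lintegral_congr fun x => ?_
  rw [ENNReal.ofReal_sum_of_nonneg fun k _ => mul_nonneg (catProb_nonneg _ _ _) (hg0 _),
    lintegral_count, tsum_fintype]
  simp only [Pi.mul_apply, ENNReal.ofReal_mul (catProb_nonneg β₀ _ _)]

lemma isProbabilityMeasure_obsLaw [IsProbabilityMeasure G] (h₀ : ∀ l, BddCoef (β₀ l)) :
    IsProbabilityMeasure (obsLaw G β₀) := by
  have hmass := lintegral_ofReal_obsLaw (G := G) h₀ (g := fun _ => 1) measurable_const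
    fun _ => zero_le_one
  simp only [mul_one, sum_catProb, ENNReal.ofReal_one, lintegral_one, measure_univ] at hmass
  exact ⟨hmass⟩

/-- The likelihood ratio `π_y(x) / π_{0y}(x)` of one observation `(x, y)`. -/
def likRatio (β β₀ : Fin q → ℝ → ℝ) (z : Curve × Fin (q + 1)) : ℝ≥0∞ :=
  ENNReal.ofReal (catProb β z.1 z.2 / catProb β₀ z.1 z.2)

lemma likRatio_ne_zero (β β₀ : Fin q → ℝ → ℝ) (z : Curve × Fin (q + 1)) :
    likRatio β β₀ z ≠ 0 :=
  (ENNReal.ofReal_pos.2 (div_pos (catProb_pos _ _ _) (catProb_pos _ _ _))).ne'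

lemma measurable_likRatio_coefFun {ψ : (J : ℕ) → Fin J → ℝ → ℝ} (hψ : ∀ J j, BddCoef (ψ J j))
    (h₀ : ∀ l, BddCoef (β₀ l)) :
    Measurable (Function.uncurry fun p : Param q => likRatio (coefFun ψ p) β₀) :=
  ((measurable_catProb_coefFun hψ).div
    ((measurable_catProb h₀).comp measurable_snd)).ennreal_ofReal

lemma lintegral_likRatio [IsProbabilityMeasure G] (h : ∀ l, BddCoef (β l))
    (h₀ : ∀ l, BddCoef (β₀ l)) : ∫⁻ z, likRatio β β₀ z ∂obsLaw G β₀ = 1 := by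
  simp only [likRatio]
  rw [lintegral_ofReal_obsLaw h₀ (g := fun z => catProb β z.1 z.2 / catProb β₀ z.1 z.2)
    ((measurable_catProb h).div (measurable_catProb h₀))
    fun z => div_nonneg (catProb_nonneg _ _ _) (catProb_nonneg _ _ _)]
  simp only [mul_div_cancel₀ _ (catProb_pos β₀ _ _).ne', sum_catProb, ENNReal.ofReal_one,
    lintegral_one, measure_univ]

lemma lintegral_inv_likRatio_le [IsProbabilityMeasure G] (h : ∀ l, BddCoef (β l))
    (h₀ : ∀ l, BddCoef (β₀ l)) {c d : ℝ} (hc : 0 < c) (hcp : ∀ᵐ x ∂G, ∀ k, c ≤ catProb β x k)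
    (hd : ∀ᵐ x ∂G, ∀ k, |catProb β x k - catProb β₀ x k| ≤ d) :
    ∫⁻ z, (likRatio β β₀ z)⁻¹ ∂obsLaw G β₀ ≤
      ENNReal.ofReal (exp ((q + 1) * (d ^ 2 / c))) := by
  have hinv (z : Curve × Fin (q + 1)) : (likRatio β β₀ z)⁻¹ =
      ENNReal.ofReal (catProb β z.1 z.2 / catProb β₀ z.1 z.2)⁻¹ :=
    (ENNReal.ofReal_inv_of_pos (div_pos (catProb_pos _ _ _) (catProb_pos _ _ _))).symm
  simp only [hinv]
  rw [lintegral_ofReal_obsLaw h₀ (g := fun z => (catProb β z.1 z.2 / catProb β₀ z.1 z.2)⁻¹)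
    ((measurable_catProb h).div (measurable_catProb h₀)).inv
    fun z => inv_nonneg.2 (div_nonneg (catProb_nonneg _ _ _) (catProb_nonneg _ _ _))]
  calc ∫⁻ x, ENNReal.ofReal (∑ k, catProb β₀ x k * (catProb β x k / catProb β₀ x k)⁻¹) ∂G
      ≤ ∫⁻ _, ENNReal.ofReal (exp ((q + 1) * (d ^ 2 / c))) ∂G := by
        refine lintegral_mono_ae ?_
        filter_upwards [hcp, hd] with x hcx hdx
        refine ENNReal.ofReal_le_ofReal ((sum_mul_inv_div_le (sum_catProb β x) (sum_catProb β₀ x)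
          (catProb_pos β₀ x) hc hcx hdx).trans ?_)
        rw [Fintype.card_fin, Nat.cast_add_one, add_comm]
        exact Real.add_one_le_exp _
    _ = ENNReal.ofReal (exp ((q + 1) * (d ^ 2 / c))) := by
        rw [lintegral_const, measure_univ, mul_one]

lemma catDist_sq (G : Measure Curve) (β β' : Fin q → ℝ → ℝ) :
    catDist G β β' ^ 2 = ∑ k, ∫ x, |catProb β x k - catProb β' x k| ^ 2 ∂G :=
  Real.sq_sqrt (Finset.sum_nonneg fun _ _ => integral_nonneg fun _ => by positivity)

lemma integrable_sq_abs_catProb_sub [IsFiniteMeasure G] (h : ∀ l, BddCoef (β l))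
    (h₀ : ∀ l, BddCoef (β₀ l)) (k : Fin (q + 1)) :
    Integrable (fun x => |catProb β x k - catProb β₀ x k| ^ 2) G := by
  have hmeas {β : Fin q → ℝ → ℝ} (h : ∀ l, BddCoef (β l)) : Measurable fun x => catProb β x k :=
    measurable_catProb_comp (fun l => (h l).continuous_linPred.measurable) measurable_const
  have hdiff : Measurable fun x => catProb β x k - catProb β₀ x k := (hmeas h).sub (hmeas h₀)
  simp only [sq_abs]
  refine .of_bound (hdiff.pow_const 2).aestronglyMeasurable 1 (ae_of_all _ fun x => ?_)
  rw [norm_pow, Real.norm_eq_abs]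
  refine pow_le_one₀ (abs_nonneg _) (abs_sub_le_of_nonneg_of_le ?_ ?_ ?_ ?_)
  exacts [catProb_nonneg β x k, catProb_le_one β x k, catProb_nonneg β₀ x k, catProb_le_one β₀ x k]

lemma lintegral_sqrt_bracket_le [IsProbabilityMeasure G] (h : ∀ l, BddCoef (β l))
    (h₀ : ∀ l, BddCoef (β₀ l)) {δ : ℝ} (hδ : 0 ≤ δ) :
    ∫⁻ z, ENNReal.ofReal √((catProb β z.1 z.2 + δ) / catProb β₀ z.1 z.2) ∂obsLaw G β₀ ≤
      ENNReal.ofReal (exp ((q + 1) * √δ - catDist G β β₀ ^ 2 / 8)) := by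
  have haff (x : Curve) : ∑ k, catProb β₀ x k * √((catProb β x k + δ) / catProb β₀ x k) ≤
      1 + (q + 1) * √δ - (∑ k, |catProb β x k - catProb β₀ x k| ^ 2) / 8 := by
    simpa only [Fintype.card_fin, Nat.cast_add_one] using sum_mul_sqrt_div_le (sum_catProb β x)
      (sum_catProb β₀ x) (catProb_nonneg β x) (catProb_pos β₀ x) hδ
  have hint : Integrable (fun x => (∑ k, |catProb β x k - catProb β₀ x k| ^ 2) / 8) G :=
    (integrable_finsetSum _ fun k _ => integrable_sq_abs_catProb_sub h h₀ k).div_const 8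
  rw [lintegral_ofReal_obsLaw h₀ (g := fun z => √((catProb β z.1 z.2 + δ) / catProb β₀ z.1 z.2))
    (((measurable_catProb h).add_const δ).div (measurable_catProb h₀)).sqrt
    fun z => Real.sqrt_nonneg _]
  refine (lintegral_mono fun x => ENNReal.ofReal_le_ofReal (haff x)).trans ?_
  have hint' : Integrable (fun x =>
      1 + (q + 1) * √δ - (∑ k, |catProb β x k - catProb β₀ x k| ^ 2) / 8) G :=
    (integrable_const _).sub hint
  rw [← ofReal_integral_eq_lintegral_ofReal hint' (ae_of_all _ fun x =>
    (Finset.sum_nonneg fun k _ =>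
      mul_nonneg (catProb_nonneg _ _ _) (Real.sqrt_nonneg _)).trans (haff x))]
  refine ENNReal.ofReal_le_ofReal ?_
  rw [integral_sub (integrable_const _) hint, integral_const, probReal_univ, one_smul,
    integral_div, integral_finsetSum _ fun k _ => integrable_sq_abs_catProb_sub h h₀ k,
    ← catDist_sq]
  linarith [Real.add_one_le_exp ((q + 1) * √δ - catDist G β β₀ ^ 2 / 8)]

lemma likelihood_eq_prod_likRatio_mul (ψ : (J : ℕ) → Fin J → ℝ → ℝ) (β₀ : Fin q → ℝ → ℝ) {n : ℕ}
    (D : Fin n → Curve × Fin (q + 1)) (p : Param q) :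
    likelihood ψ D p = (∏ i, likRatio (coefFun ψ p) β₀ (D i)) *
      ∏ i, ENNReal.ofReal (catProb β₀ (D i).1 (D i).2) := by
  rw [likelihood, ← Finset.prod_mul_distrib]
  refine Finset.prod_congr rfl fun i _ => ?_
  rw [likRatio, ← ENNReal.ofReal_mul (div_nonneg (catProb_nonneg _ _ _) (catProb_nonneg _ _ _)),
    div_mul_cancel₀ _ (catProb_pos β₀ _ _).ne']

lemma posteriorProb_eq_div (P : Measure (Param q)) (ψ : (J : ℕ) → Fin J → ℝ → ℝ)
    (β₀ : Fin q → ℝ → ℝ) {n : ℕ} (D : Fin n → Curve × Fin (q + 1)) (B : Set (Param q)) :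
    posteriorProb P ψ D B = (∫⁻ p in B, ∏ i, likRatio (coefFun ψ p) β₀ (D i) ∂P) /
      ∫⁻ p, ∏ i, likRatio (coefFun ψ p) β₀ (D i) ∂P := by
  have hpos : ∏ i, ENNReal.ofReal (catProb β₀ (D i).1 (D i).2) ≠ 0 :=
    Finset.prod_ne_zero_iff.2 fun i _ => (ENNReal.ofReal_pos.2 (catProb_pos _ _ _)).ne'
  have htop : ∏ i, ENNReal.ofReal (catProb β₀ (D i).1 (D i).2) ≠ ∞ :=
    ENNReal.prod_ne_top fun i _ => ENNReal.ofReal_ne_top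
  simp only [posteriorProb, likelihood_eq_prod_likRatio_mul ψ β₀, lintegral_mul_const' _ _ htop]
  exact ENNReal.mul_div_mul_right _ _ hpos htop

end LikRatio

/-! ### The prior and its sieves -/

section Prior

variable {q : ℕ} {ρ : Measure ℕ} {τ : (J : ℕ) → Measure (Fin q → Fin J → ℝ)}

lemma prior_apply {F : Set (Param q)} (hF : MeasurableSet F) :
    prior ρ τ F = ∑' J, ρ {J} * τ J {Θ | ⟨J, Θ⟩ ∈ F} := by
  rw [prior, Measure.sum_apply _ hF]
  refine tsum_congr fun J => ?_
  rw [Measure.smul_apply, (measurableEmbedding_sigmaMk J).map_apply, smul_eq_mul]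
  rfl

instance [IsProbabilityMeasure ρ] [∀ J, IsProbabilityMeasure (τ J)] :
    IsProbabilityMeasure (prior ρ τ) := by
  refine ⟨?_⟩
  simpa [prior_apply MeasurableSet.univ] using
    Measure.tsum_indicator_apply_singleton ρ Set.univ .univ

lemma mul_le_prior_sigmaMk_image (ρ : Measure ℕ) (τ : (J : ℕ) → Measure (Fin q → Fin J → ℝ))
    {J : ℕ} {U : Set (Fin q → Fin J → ℝ)} (hU : MeasurableSet U) :
    ρ {J} * τ J U ≤ prior ρ τ (Sigma.mk J '' U) := by
  rw [prior_apply ((measurableEmbedding_sigmaMk J).measurableSet_image' hU)]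
  refine le_trans ?_ (ENNReal.le_tsum J)
  gcongr
  exact fun Θ hΘ => ⟨Θ, hΘ, rfl⟩

/-- The parameters of dimension at most `Jb` with all coefficients in `[-A, A]`. -/
def sieve (q Jb : ℕ) (A : ℝ) : Set (Param q) := {p | p.1 ≤ Jb ∧ ∀ l j, |p.2 l j| ≤ A}

lemma measurableSet_sieve (q Jb : ℕ) (A : ℝ) : MeasurableSet (sieve q Jb A) := by
  refine MeasurableSpace.measurableSet_iInf.2 fun J => ?_
  change MeasurableSet {Θ : Fin q → Fin J → ℝ | J ≤ Jb ∧ ∀ l j, |Θ l j| ≤ A}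
  simp only [Set.ofPred_and, Set.ofPred_forall]
  exact (MeasurableSet.const _).inter
    (.iInter fun l => .iInter fun j => measurableSet_le (by fun_prop) measurable_const)

lemma prior_compl_sieve_le [IsProbabilityMeasure ρ] [∀ J, IsProbabilityMeasure (τ J)] {Jb : ℕ}
    {A : ℝ} {x : ℝ≥0∞} (hx : ∀ J ≤ Jb, τ J {Θ | ∃ l j, A < |Θ l j|} ≤ x) :
    prior ρ τ (sieve q Jb A)ᶜ ≤ ρ (Set.Ioi Jb) + x := by
  rw [prior_apply (measurableSet_sieve q Jb A).compl]
  calc ∑' J, ρ {J} * τ J {Θ | ⟨J, Θ⟩ ∈ (sieve q Jb A)ᶜ}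
      ≤ ∑' J, ((Set.Ioi Jb).indicator (fun J => ρ {J}) J + ρ {J} * x) := by
        refine ENNReal.tsum_le_tsum fun J => ?_
        rcases lt_or_ge Jb J with hJ | hJ
        · rw [Set.indicator_of_mem (Set.mem_Ioi.2 hJ)]
          exact (mul_le_of_le_one_right' prob_le_one).trans le_self_add
        · refine le_add_left (mul_le_mul_right ((measure_mono fun Θ hΘ => ?_).trans (hx J hJ)) _)
          simpa [sieve, hJ] using hΘ
    _ = ρ (Set.Ioi Jb) + x := by
        rw [ENNReal.tsum_add, Measure.tsum_indicator_apply_singleton _ _ (.of_discrete),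
          ENNReal.tsum_mul_right]
        simpa using congrArg (· * x) (Measure.tsum_indicator_apply_singleton ρ Set.univ .univ)

/-- The `k`-th cell of the partition of `[-A, A]` into cells of width `m`. -/
def gridCell (A m : ℝ) (k : ℕ) : Set ℝ := {u | |u| ≤ A ∧ ⌊(u + A) / m⌋₊ = k}

lemma abs_sub_le_of_mem_gridCell {A m u v : ℝ} {k : ℕ} (hm : 0 < m) (hu : u ∈ gridCell A m k)
    (hv : v ∈ gridCell A m k) : |u - v| ≤ m := by
  have hbounds {u : ℝ} (hu : u ∈ gridCell A m k) : k * m ≤ u + A ∧ u + A < (k + 1) * m := by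
    obtain ⟨habs, rfl⟩ := hu
    have hdiv : 0 ≤ (u + A) / m := div_nonneg (by linarith [abs_le.1 habs]) hm.le
    exact ⟨(le_div_iff₀ hm).1 (Nat.floor_le hdiv), (div_lt_iff₀ hm).1 (Nat.lt_floor_add_one _)⟩
  have hu' := hbounds hu
  have hv' := hbounds hv
  rw [abs_le]
  constructor <;> linarith

lemma exists_mem_gridCell {A m u : ℝ} {N : ℕ} (hm : 0 < m) (hN : 2 * A / m < N) (hu : |u| ≤ A) :
    ∃ k : Fin N, u ∈ gridCell A m k := by
  have hu' := abs_le.1 hu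
  have hlt : ⌊(u + A) / m⌋₊ < N := by
    rw [Nat.floor_lt (div_nonneg (by linarith) hm.le)]
    refine lt_of_le_of_lt ?_ hN
    gcongr
    linarith
  exact ⟨⟨_, hlt⟩, hu, rfl⟩

/-- The indices of the cells that cover a sieve: a dimension, and for each coefficient the index of
a cell of the line. -/
abbrev CellIndex (q Jb N : ℕ) : Type := Σ J : Fin (Jb + 1), Fin q → Fin J → Fin N

/-- The parameters whose coefficients lie in prescribed cells of the line. -/
def sieveCell {q Jb N : ℕ} (A m : ℝ) (k : CellIndex q Jb N) : Set (Param q) :=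
  Sigma.mk (k.1 : ℕ) '' {Θ | ∀ l j, Θ l j ∈ gridCell A m (k.2 l j)}

lemma sieve_subset_iUnion_sieveCell {q Jb N : ℕ} {A m : ℝ} (hm : 0 < m) (hN : 2 * A / m < N) :
    sieve q Jb A ⊆ ⋃ k : CellIndex q Jb N, sieveCell A m k := by
  rintro ⟨J, Θ⟩ ⟨hJ, hΘ⟩
  choose k hk using fun l j => exists_mem_gridCell hm hN (hΘ l j)
  exact Set.mem_iUnion.2 ⟨⟨⟨J, Nat.lt_succ_of_le hJ⟩, k⟩, Θ, hk, rfl⟩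

lemma card_cellIndex_le {q Jb N : ℕ} (hN : 1 ≤ N) :
    Fintype.card (CellIndex q Jb N) ≤ (Jb + 1) * N ^ (q * Jb) :=
  calc Fintype.card (CellIndex q Jb N) = ∑ J : Fin (Jb + 1), N ^ (q * J) := by
        simp [pow_mul, mul_comm q]
    _ ≤ ∑ _J : Fin (Jb + 1), N ^ (q * Jb) := Finset.sum_le_sum fun J _ =>
        pow_le_pow_right₀ hN (Nat.mul_le_mul_left q (Nat.le_of_lt_succ J.2))
    _ = (Jb + 1) * N ^ (q * Jb) := by simp

end Prior

/-! ### Non-asymptotic bounds -/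

section Bounds

variable {q n : ℕ} {G : Measure Curve} [IsProbabilityMeasure G] {β₀ : Fin q → ℝ → ℝ} {R : ℝ}

lemma exists_bracket {T : Type*} {S : Set T} {β : T → Fin q → ℝ → ℝ} (hR : ∀ᵐ x ∂G, ‖x‖ ≤ R)
    (hβ : ∀ θ l, BddCoef (β θ l)) (h₀ : ∀ l, BddCoef (β₀ l)) {δ η : ℝ} (hδ : 0 ≤ δ) (hη : 0 ≤ η)
    (hfar : ∀ θ ∈ S, η ≤ catDist G (β θ) β₀)
    (hclose : ∀ θ ∈ S, ∀ θ' ∈ S, ∀ x, ‖x‖ ≤ R → ∀ k,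
      |catProb (β θ) x k - catProb (β θ') x k| ≤ δ) :
    ∃ w : Curve × Fin (q + 1) → ℝ≥0∞, Measurable w ∧
      ∫⁻ z, w z ∂obsLaw G β₀ ≤ ENNReal.ofReal (exp ((q + 1) * √δ - η ^ 2 / 8)) ∧
      ∀ᵐ z ∂obsLaw G β₀, ∀ θ ∈ S, likRatio (β θ) β₀ z ≤ w z ^ 2 := by
  rcases S.eq_empty_or_nonempty with rfl | ⟨θ', hθ'⟩
  · exact ⟨0, measurable_const, by simp, by simp⟩
  have hR' : ∀ᵐ z ∂obsLaw G β₀, ‖z.1‖ ≤ R :=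
    (withDensity_absolutelyContinuous _ _).ae_le (Measure.quasiMeasurePreserving_fst.ae hR)
  refine ⟨fun z => ENNReal.ofReal √((catProb (β θ') z.1 z.2 + δ) / catProb β₀ z.1 z.2),
    (((measurable_catProb (hβ θ')).add_const δ).div (measurable_catProb h₀)).sqrt.ennreal_ofReal,
    (lintegral_sqrt_bracket_le (hβ θ') h₀ hδ).trans ?_, ?_⟩
  · gcongr
    exact hfar θ' hθ'
  · filter_upwards [hR'] with z hz θ hθ
    rw [← ENNReal.ofReal_pow (Real.sqrt_nonneg _), Real.sq_sqrt
      (div_nonneg (add_nonneg (catProb_nonneg _ _ _) hδ) (catProb_nonneg _ _ _)), likRatio]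
    gcongr
    · exact catProb_nonneg _ _ _
    · linarith [le_of_abs_le (hclose θ hθ θ' hθ' z.1 hz z.2)]

variable {ψ : (J : ℕ) → Fin J → ℝ → ℝ}

lemma measure_exists_mem_sieve_lt_prod_le (hR : ∀ᵐ x ∂G, ‖x‖ ≤ R) (hψ : ∀ J j, BddCoef (ψ J j))
    (h₀ : ∀ l, BddCoef (β₀ l)) {Jb N : ℕ} {A m d δ η : ℝ} (hm : 0 < m) (hN : 2 * A / m < N)
    (hN1 : 1 ≤ N) (hd : 0 ≤ d) (hδ : 0 ≤ δ) (hη : 0 ≤ η)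
    (hstable : ∀ J ≤ Jb, ∀ θ θ' : Fin J → ℝ, (∀ j, |θ j - θ' j| ≤ m) →
      ∀ t ∈ Set.Icc (0 : ℝ) 1, |series ψ θ t - series ψ θ' t| ≤ d)
    (hdδ : 2 * (q + 1) * R * d ≤ δ) (b : ℝ) :
    iidLaw (obsLaw G β₀) n {D | ∃ p ∈ {p | η ≤ catDist G (coefFun ψ p) β₀} ∩ sieve q Jb A,
        ENNReal.ofReal (exp (-b)) < ∏ i, likRatio (coefFun ψ p) β₀ (D i)} ≤
      ENNReal.ofReal ((Jb + 1) * N ^ (q * Jb) *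
        exp (b / 2 + n * ((q + 1) * √δ - η ^ 2 / 8))) := by
  have := isProbabilityMeasure_obsLaw (G := G) h₀
  let S (k : CellIndex q Jb N) : Set (Param q) :=
    {p | η ≤ catDist G (coefFun ψ p) β₀} ∩ sieveCell A m k
  have hcoef (p : Param q) (l : Fin q) : BddCoef (coefFun ψ p l) := bddCoef_series (hψ _) _
  have hbracket (k : CellIndex q Jb N) :=
    exists_bracket (S := S k) (β := coefFun ψ) hR hcoef h₀ hδ hη (fun p hp => hp.1) <| by
      rintro _ ⟨-, Θ, hΘ, rfl⟩ _ ⟨-, Θ', hΘ', rfl⟩ x hx y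
      have hseries (l : Fin q) : ∀ t ∈ Set.Icc (0 : ℝ) 1,
          |coefFun ψ ⟨k.1, Θ⟩ l t - coefFun ψ ⟨k.1, Θ'⟩ l t| ≤ d :=
        hstable k.1 (Nat.le_of_lt_succ k.1.2) _ _ fun j =>
          abs_sub_le_of_mem_gridCell hm (hΘ l j) (hΘ' l j)
      exact (abs_catProb_sub_le hd (hcoef _) (hcoef _) hseries hx y).trans hdδ
  have hcover : {p | η ≤ catDist G (coefFun ψ p) β₀} ∩ sieve q Jb A ⊆ ⋃ k, S k := by
    rw [← Set.inter_iUnion]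
    exact Set.inter_subset_inter_right _ (sieve_subset_iUnion_sieveCell hm hN)
  refine (measure_mono ?_).trans ((measure_exists_mem_iUnion_lt_prod_le (S := S)
    (r := fun p => likRatio (coefFun ψ p) β₀) hbracket b).trans ?_)
  · rintro D ⟨p, hp, hlt⟩
    exact ⟨p, hcover hp, hlt⟩
  · rw [ENNReal.ofReal_mul (by positivity), ← ENNReal.ofReal_natCast]
    gcongr
    exact_mod_cast card_cellIndex_le hN1

lemma measure_lintegral_prod_likRatio_lt_le {ρ : Measure ℕ} [IsProbabilityMeasure ρ]
    {τ : (J : ℕ) → Measure (Fin q → Fin J → ℝ)} [∀ J, IsProbabilityMeasure (τ J)]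
    (hψ : ∀ J j, BddCoef (ψ J j)) (h₀ : ∀ l, BddCoef (β₀ l)) {J : ℕ}
    {U : Set (Fin q → Fin J → ℝ)} (hU : MeasurableSet U) {c d : ℝ} (hc : 0 < c)
    (hcU : ∀ Θ ∈ U, ∀ᵐ x ∂G, ∀ k, c ≤ catProb (coefFun ψ ⟨J, Θ⟩) x k)
    (hdU : ∀ Θ ∈ U, ∀ᵐ x ∂G, ∀ k, |catProb (coefFun ψ ⟨J, Θ⟩) x k - catProb β₀ x k| ≤ d)
    (t : ℝ) :
    iidLaw (obsLaw G β₀) n {D | ∫⁻ p, ∏ i, likRatio (coefFun ψ p) β₀ (D i) ∂prior ρ τ <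
        ENNReal.ofReal (exp (-t)) * (ρ {J} * τ J U)} ≤
      ENNReal.ofReal (exp (n * ((q + 1) * (d ^ 2 / c)) - t)) := by
  have := isProbabilityMeasure_obsLaw (G := G) h₀
  refine (measure_mono ?_).trans (measure_lintegral_prod_lt_le (Q := prior ρ τ)
    (U := Sigma.mk J '' U) (r := fun p => likRatio (coefFun ψ p) β₀)
    (measurable_likRatio_coefFun hψ h₀) (fun _ => likRatio_ne_zero _ _)
    (fun _ _ => ENNReal.ofReal_ne_top) ((measurableEmbedding_sigmaMk J).measurableSet_image' hU)
    ?_ t)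
  · exact fun D hD => lt_of_lt_of_le hD (mul_le_mul_right (mul_le_prior_sigmaMk_image ρ τ hU) _)
  · rintro _ ⟨Θ, hΘ, rfl⟩
    exact lintegral_inv_likRatio_le (fun l => bddCoef_series (hψ _) _) h₀ hc (hcU Θ hΘ) (hdU Θ hΘ)

end Bounds

/-! ### Rates -/

/-- The dimension at which the squared approximation error, summed over the sample, balances the
prior cost of a parameter: `n J^(-2α) = J log n`. -/
def optDim (α : ℝ) (n : ℕ) : ℝ := (n / log n) ^ (1 / (2 * α + 1))

/-- The order of minus the logarithm of the prior mass near the truth. -/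
def optCost (α : ℝ) (n : ℕ) : ℝ := optDim α n * log n

/-- The order of the entropy of the sieve that captures all but `exp (-optCost)` of the prior. It is
larger than the prior cost since the upper bound on the law of the dimension is weaker than the
lower bound. -/
def sieveCost (α t : ℝ) (n : ℕ) : ℝ := optCost α n * log n ^ (1 - t)

/-- The rate at which the posterior contracts. -/
def contractionRate (α t : ℝ) (n : ℕ) : ℝ :=
  n ^ (-α / (2 * α + 1)) * log n ^ (α / (2 * α + 1) + (1 - t) / 2)

lemma eventually_one_le_log : ∀ᶠ n : ℕ in atTop, 1 ≤ log n :=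
  (Real.tendsto_log_atTop.comp tendsto_natCast_atTop_atTop).eventually_ge_atTop 1

section OptDim

variable {α : ℝ}

lemma eventually_rpow_le_optDim (hα : 0 < α) :
    ∀ᶠ n : ℕ in atTop, (n : ℝ) ^ (1 / (2 * (2 * α + 1))) ≤ optDim α n := by
  have hlog : ∀ᶠ n : ℕ in atTop, ‖log n‖ ≤ 1 * ‖(n : ℝ) ^ (1 / 2 : ℝ)‖ :=
    tendsto_natCast_atTop_atTop.eventually
      ((isLittleO_log_rpow_atTop (by norm_num : (0 : ℝ) < 1 / 2)).bound one_pos)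
  filter_upwards [hlog, eventually_one_le_log, eventually_gt_atTop 0] with n hn hl hn0
  have hn0' : (0 : ℝ) < n := Nat.cast_pos.2 hn0
  rw [one_mul, Real.norm_of_nonneg (by linarith), Real.norm_of_nonneg (by positivity)] at hn
  have hsqrt : (n : ℝ) ^ (1 / 2 : ℝ) ≤ n / log n := by
    rw [le_div_iff₀ (by linarith)]
    calc (n : ℝ) ^ (1 / 2 : ℝ) * log n ≤ (n : ℝ) ^ (1 / 2 : ℝ) * (n : ℝ) ^ (1 / 2 : ℝ) := by gcongr
      _ = n := by rw [← Real.rpow_add hn0']; norm_num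
  calc (n : ℝ) ^ (1 / (2 * (2 * α + 1))) = ((n : ℝ) ^ (1 / 2 : ℝ)) ^ (1 / (2 * α + 1)) := by
        rw [← Real.rpow_mul hn0'.le]
        congr 1
        field_simp
    _ ≤ optDim α n := Real.rpow_le_rpow (by positivity) hsqrt (by positivity)

lemma tendsto_optDim_atTop (hα : 0 < α) : Tendsto (optDim α) atTop atTop :=
  tendsto_atTop_mono' _ (eventually_rpow_le_optDim hα)
    ((tendsto_rpow_atTop (by positivity)).comp tendsto_natCast_atTop_atTop)

lemma tendsto_optCost_atTop (hα : 0 < α) : Tendsto (optCost α) atTop atTop :=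
  (tendsto_optDim_atTop hα).atTop_mul_atTop₀
    (Real.tendsto_log_atTop.comp tendsto_natCast_atTop_atTop)

lemma eventually_mul_log_le_log_optDim (hα : 0 < α) :
    ∀ᶠ n : ℕ in atTop, 1 / (2 * (2 * α + 1)) * log n ≤ log (optDim α n) := by
  filter_upwards [eventually_rpow_le_optDim hα, eventually_gt_atTop 0] with n hn hn0
  have hn0' : (0 : ℝ) < n := Nat.cast_pos.2 hn0
  rw [← Real.log_rpow hn0']
  exact Real.log_le_log (by positivity) hn

lemma eventually_mul_optDim_rpow (hα : 0 < α) :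
    ∀ᶠ n : ℕ in atTop, n * optDim α n ^ (-(2 * α)) = optCost α n := by
  filter_upwards [eventually_one_le_log, eventually_gt_atTop 0,
    (tendsto_optDim_atTop hα).eventually_gt_atTop 0] with n hl hn0 hy
  have : (0 : ℝ) < n := Nat.cast_pos.2 hn0
  have hdim : optDim α n ^ (2 * α + 1) = n / log n := by
    rw [optDim, ← Real.rpow_mul (by positivity), one_div, inv_mul_cancel₀ (by positivity),
      Real.rpow_one]
  have hn : (n : ℝ) = optDim α n ^ (2 * α + 1) * log n := by
    rw [hdim]
    field_simp
  calc n * optDim α n ^ (-(2 * α))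
      = optDim α n ^ (2 * α + 1) * optDim α n ^ (-(2 * α)) * log n := by
        nth_rewrite 1 [hn]
        ring
    _ = optCost α n := by
        rw [← Real.rpow_add hy, show 2 * α + 1 + -(2 * α) = 1 by ring, Real.rpow_one, optCost]

lemma eventually_optCost_le (hα : 0 < α) : ∀ᶠ n : ℕ in atTop, optCost α n ≤ n := by
  filter_upwards [eventually_mul_optDim_rpow hα, (tendsto_optDim_atTop hα).eventually_ge_atTop 1]
    with n hn hy
  rw [← hn]
  exact mul_le_of_le_one_right n.cast_nonneg
    (Real.rpow_le_one_of_one_le_of_nonpos hy (by linarith))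

lemma eventually_optCost_le_sieveCost (hα : 0 < α) {t : ℝ} (ht : t ≤ 1) :
    ∀ᶠ n : ℕ in atTop, optCost α n ≤ sieveCost α t n := by
  filter_upwards [eventually_one_le_log, (tendsto_optCost_atTop hα).eventually_ge_atTop 0]
    with n hl hS
  exact le_mul_of_one_le_right hS (Real.one_le_rpow hl (by linarith))

lemma eventually_mul_contractionRate_sq (hα : 0 < α) (t : ℝ) :
    ∀ᶠ n : ℕ in atTop, n * contractionRate α t n ^ 2 = sieveCost α t n := by
  filter_upwards [eventually_one_le_log, eventually_gt_atTop 0,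
    eventually_mul_optDim_rpow hα] with n hl hn0 hy
  have hn0' : (0 : ℝ) < n := Nat.cast_pos.2 hn0
  have hpos : 0 < log n := by linarith
  rw [sieveCost, contractionRate, ← hy, mul_assoc, optDim, ← Real.rpow_mul (by positivity),
    Real.div_rpow hn0'.le hpos.le, mul_pow, ← Real.rpow_natCast, ← Real.rpow_natCast,
    ← Real.rpow_mul hn0'.le, ← Real.rpow_mul hpos.le,
    div_mul_eq_mul_div ((n : ℝ) ^ _), mul_div_assoc ((n : ℝ) ^ _), ← Real.rpow_sub hpos]
  congr 3
  · push_cast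
    field_simp
  · push_cast
    field_simp
    ring

lemma eventually_ceil_optDim (hα : 0 < α) :
    ∀ᶠ n : ℕ in atTop, optDim α n ≤ ⌈optDim α n⌉₊ ∧ ⌈optDim α n⌉₊ ≤ 2 * optDim α n ∧
      1 ≤ log ⌈optDim α n⌉₊ ∧ log ⌈optDim α n⌉₊ ≤ log n := by
  filter_upwards [eventually_one_le_log, eventually_optCost_le hα,
    (tendsto_optDim_atTop hα).eventually_ge_atTop (exp 1)] with n hl hn hy
  have hy1 : 1 ≤ optDim α n := (Real.one_le_exp zero_le_one).trans hy
  have hle : optDim α n ≤ ⌈optDim α n⌉₊ := Nat.le_ceil _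
  have hlen : (⌈optDim α n⌉₊ : ℝ) ≤ n := by
    exact_mod_cast Nat.ceil_le.2 ((le_mul_of_one_le_right (by linarith) hl).trans hn)
  refine ⟨hle, by linarith [Nat.ceil_lt_add_one (by linarith : 0 ≤ optDim α n)], ?_,
    Real.log_le_log (by linarith) hlen⟩
  rw [Real.le_log_iff_exp_le (by linarith)]
  exact hy.trans hle

lemma eventually_mul_log_rpow_le (hα : 0 < α) {t : ℝ} (ht₀ : 0 ≤ t) (ht₁ : t ≤ 1) :
    ∀ᶠ n : ℕ in atTop, ∀ J : ℕ, optDim α n ≤ J →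
      1 ≤ log J ^ t ∧ 1 / (2 * (2 * α + 1)) * log n ^ t ≤ log J ^ t := by
  filter_upwards [eventually_one_le_log, eventually_mul_log_le_log_optDim hα,
    (tendsto_optDim_atTop hα).eventually_ge_atTop (exp 1)] with n hl hlog hy J hJ
  have hJ0 : (0 : ℝ) < J := (Real.exp_pos 1).trans_le (hy.trans hJ)
  refine ⟨Real.one_le_rpow ((Real.le_log_iff_exp_le hJ0).2 (hy.trans hJ)) ht₀, ?_⟩
  set κ := 1 / (2 * (2 * α + 1)) with hκ
  have hκ0 : 0 < κ := by positivity
  have hκ1 : κ ≤ 1 := by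
    rw [hκ, div_le_one (by positivity)]
    linarith
  calc κ * log n ^ t ≤ κ ^ t * log n ^ t := by
        gcongr
        simpa using Real.rpow_le_rpow_of_exponent_ge hκ0 hκ1 ht₁
    _ = (κ * log n) ^ t := (Real.mul_rpow hκ0.le (by linarith)).symm
    _ ≤ log J ^ t := Real.rpow_le_rpow (by positivity)
        (hlog.trans (Real.log_le_log ((Real.exp_pos 1).trans_le hy) hJ)) ht₀

end OptDim

/-! ### The prior mass near the truth -/

section Evidence

variable {q : ℕ} {ψ : (J : ℕ) → Fin J → ℝ → ℝ} {β₀ : Fin q → ℝ → ℝ} {α H K₀ t₁ t₂ : ℝ}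
  {ρ : Measure ℕ} {τ : (J : ℕ) → Measure (Fin q → Fin J → ℝ)}

lemma DimPriorCond.exists_exp_le_real_ceil_optDim (h : DimPriorCond ρ t₁ t₂) (hα : 0 < α)
    (ht₁ : t₁ ≤ 1) :
    ∃ a ≥ 0, ∀ᶠ n : ℕ in atTop, exp (-(a * optCost α n)) ≤ ρ.real {⌈optDim α n⌉₊} := by
  obtain ⟨c₁, hc₁, c₂, -, j₀, h⟩ := h
  refine ⟨2 * c₁, by positivity, ?_⟩
  filter_upwards [eventually_ceil_optDim hα, (tendsto_optDim_atTop hα).eventually_ge_atTop j₀]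
    with n ⟨hJ, hJ2, hlog, hlogn⟩ hj₀
  have hlogpow : log ⌈optDim α n⌉₊ ^ t₁ ≤ log n :=
    (Real.rpow_le_self_of_one_le hlog ht₁).trans hlogn
  refine le_trans (Real.exp_le_exp.2 ?_) (h _ (by exact_mod_cast hj₀.trans hJ)).1
  have hmul : (⌈optDim α n⌉₊ : ℝ) * log ⌈optDim α n⌉₊ ^ t₁ ≤ 2 * optDim α n * log n :=
    mul_le_mul hJ2 hlogpow (by positivity) ((Nat.cast_nonneg _).trans hJ2)
  rw [optCost]
  linarith [mul_le_mul_of_nonneg_left hmul hc₁.le]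

lemma CoefPriorConc.exists_exp_le_real_sqrt_le [∀ J, IsProbabilityMeasure (τ J)]
    (h : CoefPriorConc τ H) (hα : 0 < α) {A : ℝ} (hA : 0 ≤ A) :
    ∃ a ≥ 0, ∀ᶠ n : ℕ in atTop, ∀ Θ₀ : Fin q → Fin ⌈optDim α n⌉₊ → ℝ, (∀ l j, |Θ₀ l j| ≤ H) →
      exp (-(a * optCost α n)) ≤ (τ ⌈optDim α n⌉₊).real
        {Θ | √(∑ l, ∑ j, (Θ l j - Θ₀ l j) ^ 2) ≤ (⌈optDim α n⌉₊ : ℝ) ^ (-A)} := by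
  obtain ⟨c₃, hc₃, ε₀, hε₀, s, hs, h⟩ := h
  set r : ℝ := min ε₀ 1
  have hr0 : 0 < r := lt_min hε₀ one_pos
  refine ⟨2 * c₃ * (1 + (A + s)), by positivity, ?_⟩
  filter_upwards [eventually_ceil_optDim hα, (tendsto_optDim_atTop hα).eventually_ge_atTop 1,
    (Real.tendsto_log_atTop.comp tendsto_natCast_atTop_atTop).eventually_ge_atTop (log (1 / r))]
    with n ⟨hyJ, hJ2, hlog, hlogn⟩ hy hlr
  set J := ⌈optDim α n⌉₊
  intro Θ₀ hΘ₀
  have hJ1 : (1 : ℝ) ≤ J := hy.trans hyJ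
  have hpow {u v : ℝ} (huv : u ≤ v) : (J : ℝ) ^ (-v) ≤ (J : ℝ) ^ (-u) :=
    Real.rpow_le_rpow_of_exponent_le hJ1 (neg_le_neg huv)
  set η : ℝ := r * (J : ℝ) ^ (-(A + s)) with hη
  have hη0 : 0 < η := by positivity
  have hηε : η ≤ ε₀ * (J : ℝ) ^ (-s) :=
    mul_le_mul (min_le_left _ _) (hpow (by linarith)) (by positivity) hε₀.le
  have hηA : η ≤ (J : ℝ) ^ (-A) :=
    (mul_le_of_le_one_left (by positivity) (min_le_right _ _)).trans (hpow (by linarith))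
  have hηlog : log (1 / η) = log (1 / r) + (A + s) * log J := by
    rw [hη, one_div, Real.log_inv, Real.log_mul hr0.ne' (by positivity),
      Real.log_rpow (by linarith), one_div, Real.log_inv]
    ring
  have hJη : J * log (1 / η) ≤ 2 * optDim α n * ((1 + (A + s)) * log n) := by
    rw [hηlog]
    simp only [Function.comp_apply] at hlr
    have hmul : (A + s) * log J ≤ (A + s) * log n := by gcongr
    have : 0 ≤ (1 + (A + s)) * log n := mul_nonneg (by positivity) (by linarith)
    calc J * (log (1 / r) + (A + s) * log J) ≤ J * ((1 + (A + s)) * log n) := by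
          gcongr
          linarith
      _ ≤ 2 * optDim α n * ((1 + (A + s)) * log n) := by gcongr
  refine (Real.exp_le_exp.2 ?_).trans ((h J (by exact_mod_cast hJ1) Θ₀ hΘ₀ η hη0 hηε).trans
    (measureReal_mono fun Θ hΘ => le_trans hΘ hηA))
  rw [optCost]
  linarith [mul_le_mul_of_nonneg_left hJη hc₃.le]

lemma exists_forall_basisApprox (h : ∀ l, BasisApprox ψ (β₀ l) α H) :
    ∃ C > 0, ∀ J : ℕ, 1 ≤ J → ∃ Θ₀ : Fin q → Fin J → ℝ, (∀ l j, |Θ₀ l j| ≤ H) ∧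
      ∀ l, ∀ t ∈ Set.Icc (0 : ℝ) 1, |β₀ l t - series ψ (Θ₀ l) t| ≤ C * (J : ℝ) ^ (-α) := by
  choose C hC h using h
  have hle (l : Fin q) : C l ≤ 1 + ∑ l, C l :=
    (Finset.single_le_sum (fun l _ => (hC l).le) (Finset.mem_univ l)).trans (by linarith)
  refine ⟨1 + ∑ l, C l, add_pos_of_pos_of_nonneg one_pos
    (Finset.sum_nonneg fun l _ => (hC l).le), fun J hJ => ?_⟩
  choose Θ₀ hΘ₀ happrox using fun l => h l J hJ
  refine ⟨Θ₀, hΘ₀, fun l t ht => (happrox l t ht).trans ?_⟩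
  gcongr
  exact hle l

lemma exists_abs_series_sub_le_rpow (hStable : BasisStable ψ K₀)
    (hApprox : ∀ l, BasisApprox ψ (β₀ l) α H) :
    ∃ C > 0, ∀ J : ℕ, 1 ≤ J → ∃ Θ₀ : Fin q → Fin J → ℝ, (∀ l j, |Θ₀ l j| ≤ H) ∧
      ∀ Θ : Fin q → Fin J → ℝ, √(∑ l, ∑ j, (Θ l j - Θ₀ l j) ^ 2) ≤ (J : ℝ) ^ (-(K₀ + α)) →
        ∀ l, ∀ t ∈ Set.Icc (0 : ℝ) 1, |series ψ (Θ l) t - β₀ l t| ≤ C * (J : ℝ) ^ (-α) := by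
  obtain ⟨C, hC, hStable⟩ := hStable
  obtain ⟨D, hD, hApprox⟩ := exists_forall_basisApprox hApprox
  refine ⟨C + D, by positivity, fun J hJ => ?_⟩
  obtain ⟨Θ₀, hΘ₀, happrox⟩ := hApprox J hJ
  refine ⟨Θ₀, hΘ₀, fun Θ hΘ l t ht => ?_⟩
  have hJ0 : (0 : ℝ) < J := by exact_mod_cast hJ
  have hrow : √(∑ j, (Θ l j - Θ₀ l j) ^ 2) ≤ (J : ℝ) ^ (-(K₀ + α)) :=
    (Real.sqrt_le_sqrt (Finset.single_le_sum (f := fun l => ∑ j, (Θ l j - Θ₀ l j) ^ 2)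
      (fun l _ => by positivity) (Finset.mem_univ l))).trans hΘ
  have hstable : |series ψ (Θ l) t - series ψ (Θ₀ l) t| ≤ C * (J : ℝ) ^ (-α) :=
    calc |series ψ (Θ l) t - series ψ (Θ₀ l) t|
        ≤ C * (J : ℝ) ^ K₀ * √(∑ j, (Θ l j - Θ₀ l j) ^ 2) := hStable J hJ _ _ t ht
      _ ≤ C * (J : ℝ) ^ K₀ * (J : ℝ) ^ (-(K₀ + α)) := by gcongr
      _ = C * (J : ℝ) ^ (-α) := by
        rw [mul_assoc, ← Real.rpow_add hJ0, neg_add, add_neg_cancel_left]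
  calc |series ψ (Θ l) t - β₀ l t|
      ≤ |series ψ (Θ l) t - series ψ (Θ₀ l) t| + |series ψ (Θ₀ l) t - β₀ l t| :=
        abs_sub_le _ _ _
    _ ≤ (C + D) * (J : ℝ) ^ (-α) := by
        rw [abs_sub_comm (series ψ (Θ₀ l) t), add_mul]
        exact add_le_add hstable (happrox l t ht)

variable {G : Measure Curve} [IsProbabilityMeasure G] {R : ℝ}

lemma exists_abs_catProb_sub_le (hψ : ∀ J j, BddCoef (ψ J j)) (h₀ : ∀ l, BddCoef (β₀ l))
    (hR : 0 ≤ R) (hα : 0 < α) (hStable : BasisStable ψ K₀)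
    (hApprox : ∀ l, BasisApprox ψ (β₀ l) α H) :
    ∃ E ≥ 0, ∀ᶠ n : ℕ in atTop, ∃ Θ₀ : Fin q → Fin ⌈optDim α n⌉₊ → ℝ, (∀ l j, |Θ₀ l j| ≤ H) ∧
      ∀ Θ, √(∑ l, ∑ j, (Θ l j - Θ₀ l j) ^ 2) ≤ (⌈optDim α n⌉₊ : ℝ) ^ (-(K₀ + α)) →
        ∀ x : Curve, ‖x‖ ≤ R → ∀ k,
          |catProb (coefFun ψ ⟨⌈optDim α n⌉₊, Θ⟩) x k - catProb β₀ x k| ≤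
            E * optDim α n ^ (-α) := by
  obtain ⟨C, hC, h⟩ := exists_abs_series_sub_le_rpow hStable hApprox
  refine ⟨2 * (q + 1) * R * C, by positivity, ?_⟩
  filter_upwards [(tendsto_optDim_atTop hα).eventually_gt_atTop 0] with n hy
  obtain ⟨Θ₀, hΘ₀, hclose⟩ := h _ (Nat.one_le_ceil_iff.2 hy)
  refine ⟨Θ₀, hΘ₀, fun Θ hΘ x hx k => (abs_catProb_sub_le (by positivity)
    (fun l => bddCoef_series (hψ _) _) h₀ (hclose Θ hΘ) hx k).trans ?_⟩
  have hpow : (⌈optDim α n⌉₊ : ℝ) ^ (-α) ≤ optDim α n ^ (-α) :=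
    Real.rpow_le_rpow_of_nonpos hy (Nat.le_ceil _) (by linarith)
  calc 2 * (q + 1) * R * (C * (⌈optDim α n⌉₊ : ℝ) ^ (-α))
      ≤ 2 * (q + 1) * R * (C * optDim α n ^ (-α)) := by gcongr
    _ = 2 * (q + 1) * R * C * optDim α n ^ (-α) := by ring

end Evidence

/-! ### The three parts of the contraction argument -/

section Contraction

variable {q : ℕ} {ψ : (J : ℕ) → Fin J → ℝ → ℝ} {β₀ : Fin q → ℝ → ℝ} {α H K₀ t t₁ t₂ : ℝ}
  {ρ : Measure ℕ} [IsProbabilityMeasure ρ] {τ : (J : ℕ) → Measure (Fin q → Fin J → ℝ)}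

/-- The largest dimension in the sieve. -/
def maxDim (α t L : ℝ) (n : ℕ) : ℕ := ⌊L * (optDim α n * log n ^ (1 - t))⌋₊

lemma eventually_maxDim (hα : 0 < α) (ht₀ : 0 ≤ t) (ht : t ≤ 1) {L : ℝ} (hL : 2 ≤ L) :
    ∀ᶠ n : ℕ in atTop, optDim α n ≤ maxDim α t L n ∧
      L / 2 * (optDim α n * log n ^ (1 - t)) ≤ maxDim α t L n ∧
      maxDim α t L n * log n ≤ L * sieveCost α t n ∧ (maxDim α t L n : ℝ) ≤ n ^ 2 := by
  filter_upwards [eventually_one_le_log, eventually_ge_atTop ⌈L⌉₊, eventually_optCost_le hα,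
    (tendsto_optDim_atTop hα).eventually_ge_atTop 1] with n hl hn hcost hy
  have hLn : L ≤ n := Nat.ceil_le.1 hn
  set x := optDim α n * log n ^ (1 - t) with hx
  have hyx : optDim α n ≤ x :=
    le_mul_of_one_le_right (by linarith) (Real.one_le_rpow hl (by linarith))
  have hxn : x ≤ n := by
    refine le_trans ?_ hcost
    rw [hx, optCost]
    gcongr
    exact Real.rpow_le_self_of_one_le hl (by linarith)
  have hlt : L * x < maxDim α t L n + 1 := Nat.lt_floor_add_one _
  have hle : (maxDim α t L n : ℝ) ≤ L * x := Nat.floor_le (by nlinarith)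
  have hhalf : L / 2 * x ≤ maxDim α t L n := by nlinarith
  refine ⟨by nlinarith, hhalf, ?_, by nlinarith⟩
  calc (maxDim α t L n : ℝ) * log n ≤ L * x * log n := by gcongr
    _ = L * sieveCost α t n := by rw [hx, sieveCost, optCost]; ring

lemma real_Ioi_le_of_real_singleton_le {N : ℕ} {x r : ℝ} (hx : 0 ≤ x) (hr₀ : 0 ≤ r) (hr₁ : r < 1)
    (h : ∀ J > N, ρ.real {J} ≤ x * r ^ J) : ρ.real (Set.Ioi N) ≤ x * (1 - r)⁻¹ := by
  have hsum := (summable_geometric_of_lt_one hr₀ hr₁).mul_left x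
  have hpos (J : ℕ) : 0 ≤ x * r ^ J := by positivity
  rw [← tsum_geometric_of_lt_one hr₀ hr₁, ← tsum_mul_left]
  refine ENNReal.toReal_le_of_le_ofReal (tsum_nonneg hpos) ?_
  rw [ENNReal.ofReal_tsum_of_nonneg hpos hsum,
    ← Measure.tsum_indicator_apply_singleton ρ (Set.Ioi N) .of_discrete]
  refine ENNReal.tsum_le_tsum fun J => Set.indicator_apply_le' (fun hJ => ?_) fun _ => zero_le
  rw [← ofReal_measureReal]
  exact ENNReal.ofReal_le_ofReal (h J hJ)

lemma eventually_exp_neg_le_mul_pow (hα : 0 < α) (ht₀ : 0 ≤ t) (ht : t ≤ 1) {b c L : ℝ}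
    (hc : 0 < c) (hL : 2 ≤ L) (hb : 4 * b ≤ L * (c * (1 / (2 * (2 * α + 1))))) :
    ∀ᶠ n : ℕ in atTop, ∀ J > maxDim α t L n,
      exp (-c * J * log J ^ t) ≤ exp (-(b * optCost α n)) * exp (-(c / 2)) ^ J := by
  filter_upwards [eventually_one_le_log, eventually_maxDim hα ht₀ ht hL,
    eventually_mul_log_rpow_le hα ht₀ ht, (tendsto_optDim_atTop hα).eventually_ge_atTop 0]
    with n hl ⟨hdim, hdim', _, _⟩ hlog hy J hJ
  set κ : ℝ := 1 / (2 * (2 * α + 1))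
  have : 0 < κ := by positivity
  have hNJ : (maxDim α t L n : ℝ) ≤ J := by exact_mod_cast hJ.le
  obtain ⟨hone, hκJ⟩ := hlog J (hdim.trans hNJ)
  have hJone : (J : ℝ) ≤ J * log J ^ t := le_mul_of_one_le_right J.cast_nonneg hone
  have hsplit : log n = log n ^ (1 - t) * log n ^ t := by
    rw [← Real.rpow_add (by linarith), sub_add_cancel, Real.rpow_one]
  have hcost : b * optCost α n ≤ c / 2 * (J * log J ^ t) :=
    calc b * optCost α n ≤ L * (c * κ) / 4 * (optDim α n * log n) := by
          rw [optCost]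
          gcongr
          linarith
      _ = c / 2 * (L / 2 * (optDim α n * log n ^ (1 - t)) * (κ * log n ^ t)) := by
          nth_rewrite 1 [hsplit]
          ring
      _ ≤ c / 2 * (J * log J ^ t) := by gcongr; exact hdim'.trans hNJ
  rw [← Real.exp_nat_mul, ← Real.exp_add, Real.exp_le_exp]
  linarith [mul_le_mul_of_nonneg_left hJone hc.le]

lemma DimPriorCond.exists_real_Ioi_maxDim_le (h : DimPriorCond ρ t₁ t₂) (hα : 0 < α)
    (ht₀ : 0 ≤ t₂) (ht : t₂ ≤ 1) (a : ℝ) :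
    ∃ L ≥ 2, ∀ᶠ n : ℕ in atTop,
      ρ.real (Set.Ioi (maxDim α t₂ L n)) ≤ exp (-(a * optCost α n)) / 2 := by
  obtain ⟨c₁, -, c₂, hc₂, j₀, h⟩ := h
  set L : ℝ := max 2 (4 * (a + 1) / (c₂ * (1 / (2 * (2 * α + 1)))))
  have hL : 2 ≤ L := le_max_left _ _
  refine ⟨L, hL, ?_⟩
  set r := exp (-(c₂ / 2))
  have hr₁ : r < 1 := Real.exp_lt_one_iff.2 (by linarith)
  have hhalf : ∀ᶠ n : ℕ in atTop, exp (-optCost α n) * (1 - r)⁻¹ ≤ 1 / 2 := by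
    have hlim := (Real.tendsto_exp_neg_atTop_nhds_zero.comp
      (tendsto_optCost_atTop hα)).mul_const (1 - r)⁻¹
    rw [zero_mul] at hlim
    exact hlim.eventually_le_const (by norm_num)
  filter_upwards [hhalf, eventually_maxDim hα ht₀ ht hL, eventually_exp_neg_le_mul_pow hα ht₀ ht
    hc₂ hL ((div_le_iff₀ (by positivity)).1 (le_max_right _ _)),
    (tendsto_optDim_atTop hα).eventually_ge_atTop j₀] with n hhalf ⟨hdim, _, _, _⟩ hpow hj₀
  have hmass (J : ℕ) (hJ : J > maxDim α t₂ L n) :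
      ρ.real {J} ≤ exp (-((a + 1) * optCost α n)) * r ^ J := by
    have hjN : j₀ ≤ maxDim α t₂ L n := by exact_mod_cast hj₀.trans hdim
    exact (h J (hjN.trans hJ.le)).2.trans (hpow J hJ)
  calc ρ.real (Set.Ioi (maxDim α t₂ L n)) ≤ exp (-((a + 1) * optCost α n)) * (1 - r)⁻¹ :=
        real_Ioi_le_of_real_singleton_le (Real.exp_nonneg _) (Real.exp_nonneg _) hr₁ hmass
    _ = exp (-(a * optCost α n)) * (exp (-optCost α n) * (1 - r)⁻¹) := by
        rw [← mul_assoc, ← Real.exp_add]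
        ring_nf
    _ ≤ exp (-(a * optCost α n)) * (1 / 2) := by gcongr
    _ = exp (-(a * optCost α n)) / 2 := by ring

lemma sq_mul_exp_neg_mul_sq_le {x C a S : ℝ} (ha : 0 ≤ a) (hx : 0 ≤ x) (hS : S ≤ x)
    (hC : 2 + a ≤ x * C) : x ^ 2 * exp (-C * x ^ 2) ≤ exp (-(a * S)) / 2 := by
  have hquad : 2 * x ^ 2 ≤ exp (2 * x) := by
    have := Real.quadratic_le_exp_of_nonneg (x := 2 * x) (by positivity)
    nlinarith
  have hexp : exp (2 * x) * exp (-C * x ^ 2) ≤ exp (-(a * S)) := by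
    rw [← Real.exp_add, Real.exp_le_exp]
    nlinarith [mul_le_mul_of_nonneg_left hC hx, mul_le_mul_of_nonneg_left hS ha]
  linarith [mul_le_mul_of_nonneg_right hquad (Real.exp_nonneg (-C * x ^ 2))]

lemma CoefPriorTail.exists_real_exists_lt_abs_le (h : CoefPriorTail τ) (hα : 0 < α) {a : ℝ}
    (ha : 0 ≤ a) :
    ∃ m : ℕ, ∀ᶠ n : ℕ in atTop, ∀ J : ℕ, (J : ℝ) ≤ n ^ 2 →
      (τ J).real {Θ | ∃ l j, (n : ℝ) ^ m < |Θ l j|} ≤ exp (-(a * optCost α n)) / 2 := by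
  obtain ⟨C, hC, t₃, ht₃, M₀, -, h⟩ := h
  set m : ℕ := ⌈2 / t₃⌉₊
  have hm : 2 ≤ m * t₃ := (div_le_iff₀ ht₃).1 (Nat.le_ceil _)
  have hm0 : m ≠ 0 := (Nat.ceil_pos.2 (by positivity)).ne'
  refine ⟨m, ?_⟩
  filter_upwards [eventually_optCost_le hα, eventually_ge_atTop 1,
    tendsto_natCast_atTop_atTop.eventually_ge_atTop M₀,
    tendsto_natCast_atTop_atTop.eventually_ge_atTop ((2 + a) / C)] with n hcost hn hM₀ hnC J hJ
  have hn1 : (1 : ℝ) ≤ n := by exact_mod_cast hn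
  have hpow : (n : ℝ) ^ 2 ≤ ((n : ℝ) ^ m) ^ t₃ := by
    rw [← Real.rpow_natCast, ← Real.rpow_natCast, ← Real.rpow_mul (by positivity)]
    exact Real.rpow_le_rpow_of_exponent_le hn1 (by exact_mod_cast hm)
  calc (τ J).real {Θ | ∃ l j, (n : ℝ) ^ m < |Θ l j|}
      ≤ J * exp (-C * ((n : ℝ) ^ m) ^ t₃) := h J _ (hM₀.trans (le_self_pow₀ hn1 hm0))
    _ ≤ n ^ 2 * exp (-C * n ^ 2) := by
        gcongr ?_ * exp ?_
        exact mul_le_mul_of_nonpos_left hpow (by linarith)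
    _ ≤ exp (-(a * optCost α n)) / 2 :=
        sq_mul_exp_neg_mul_sq_le ha (by positivity) hcost ((div_le_iff₀ hC).1 hnC)

variable [∀ J, IsProbabilityMeasure (τ J)] {G : Measure Curve} [IsProbabilityMeasure G] {R : ℝ}

lemma exists_eventually_evidence_lt_le (hψ : ∀ J j, BddCoef (ψ J j)) (h₀ : ∀ l, BddCoef (β₀ l))
    (hR : ∀ᵐ x ∂G, ‖x‖ ≤ R) (hα : 0 < α) (hK₀ : 0 ≤ K₀) (ht₁ : t₁ ≤ 1)
    (hStable : BasisStable ψ K₀) (hApprox : ∀ l, BasisApprox ψ (β₀ l) α H)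
    (hDim : DimPriorCond ρ t₁ t₂) (hConc : CoefPriorConc τ H) :
    ∃ a ≥ 0, ∀ᶠ n : ℕ in atTop, iidLaw (obsLaw G β₀) n
        {D | ∫⁻ p, ∏ i, likRatio (coefFun ψ p) β₀ (D i) ∂prior ρ τ <
          ENNReal.ofReal (exp (-(a * optCost α n)))} ≤
      ENNReal.ofReal (exp (-optCost α n)) := by
  have hR0 : 0 ≤ R := let ⟨x, hx⟩ := hR.exists; (norm_nonneg x).trans hx
  obtain ⟨c, hc, hcR⟩ := exists_pos_le_catProb h₀ R
  obtain ⟨E, _, hclose⟩ := exists_abs_catProb_sub_le hψ h₀ hR0 hα hStable hApprox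
  obtain ⟨a₁, ha₁, hρ⟩ := hDim.exists_exp_le_real_ceil_optDim hα ht₁
  obtain ⟨a₂, ha₂, hτ⟩ := hConc.exists_exp_le_real_sqrt_le hα (add_nonneg hK₀ hα.le)
  set b : ℝ := (q + 1) * (E ^ 2 / (c / 2)) with hb
  refine ⟨b + 1 + (a₁ + a₂), by positivity, ?_⟩
  have hsmall : Tendsto (fun n => E * optDim α n ^ (-α)) atTop (𝓝 0) := by
    simpa using ((tendsto_rpow_neg_atTop hα).comp (tendsto_optDim_atTop hα)).const_mul E
  filter_upwards [hclose, hρ, hτ, hsmall.eventually_le_const (half_pos hc),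
    eventually_mul_optDim_rpow hα, (tendsto_optDim_atTop hα).eventually_ge_atTop 0]
    with n ⟨Θ₀, hΘ₀, hclose⟩ hρ hτ hsmall hn hy
  have hbound := measure_lintegral_prod_likRatio_lt_le (n := n) (ρ := ρ) (τ := τ) (G := G) hψ h₀
    (U := {Θ | √(∑ l, ∑ j, (Θ l j - Θ₀ l j) ^ 2) ≤ (⌈optDim α n⌉₊ : ℝ) ^ (-(K₀ + α))})
    (measurableSet_le (by fun_prop) measurable_const) (half_pos hc)
    (fun Θ hΘ => hR.mono fun x hx k => by
      linarith [(abs_le.1 (hclose Θ hΘ x hx k)).1, hcR x hx k])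
    (fun Θ hΘ => hR.mono fun x hx => hclose Θ hΘ x hx) ((b + 1) * optCost α n)
  refine (measure_mono ?_).trans (hbound.trans ?_)
  · intro D hD
    rw [Set.mem_ofPred_eq] at hD ⊢
    refine hD.trans_le ?_
    rw [add_mul (b + 1), neg_add, ← ofReal_exp_mul_ofReal_exp, add_mul a₁, neg_add,
      ← ofReal_exp_mul_ofReal_exp, ← ofReal_measureReal, ← ofReal_measureReal]
    gcongr
    exact hτ Θ₀ hΘ₀
  · have hsq : (optDim α n ^ (-α)) ^ 2 = optDim α n ^ (-(2 * α)) := by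
      rw [← Real.rpow_mul_natCast hy]
      ring_nf
    refine ENNReal.ofReal_le_ofReal (Real.exp_le_exp.2 (le_of_eq ?_))
    rw [mul_pow, hsq, add_mul, ← hn, hb]
    ring

lemma exists_eventually_prior_compl_sieve_le (hα : 0 < α) (ht₀ : 0 ≤ t₂) (ht : t₂ ≤ 1)
    (hDim : DimPriorCond ρ t₁ t₂) (hTail : CoefPriorTail τ) {a : ℝ} (ha : 0 ≤ a) :
    ∃ L ≥ 2, ∃ m : ℕ, ∀ᶠ n : ℕ in atTop,
      prior ρ τ (sieve q (maxDim α t₂ L n) ((n : ℝ) ^ m))ᶜ ≤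
        ENNReal.ofReal (exp (-(a * optCost α n))) := by
  obtain ⟨L, hL, hρ⟩ := hDim.exists_real_Ioi_maxDim_le hα ht₀ ht a
  obtain ⟨m, hτ⟩ := hTail.exists_real_exists_lt_abs_le hα ha
  refine ⟨L, hL, m, ?_⟩
  filter_upwards [hρ, hτ, eventually_maxDim hα ht₀ ht hL] with n hρ hτ ⟨_, _, _, hdim⟩
  have htail : ∀ J ≤ maxDim α t₂ L n, τ J {Θ | ∃ l j, (n : ℝ) ^ m < |Θ l j|} ≤
      ENNReal.ofReal (exp (-(a * optCost α n)) / 2) := fun J hJ => by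
    rw [← ofReal_measureReal]
    exact ENNReal.ofReal_le_ofReal (hτ J (le_trans (by exact_mod_cast hJ) hdim))
  refine (prior_compl_sieve_le htail).trans ?_
  rw [← ofReal_measureReal, ← ENNReal.ofReal_add (by positivity) (by positivity)]
  exact ENNReal.ofReal_le_ofReal (by linarith)

lemma eventually_card_cells_le (hα : 0 < α) (ht₀ : 0 ≤ t) (ht : t ≤ 1) {L : ℝ} (hL : 2 ≤ L)
    (q k : ℕ) :
    ∀ᶠ n : ℕ in atTop,
      ((maxDim α t L n : ℝ) + 1) * ((2 * n ^ k + 1 : ℕ) : ℝ) ^ (q * maxDim α t L n) ≤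
        exp ((1 + q * (k + 2)) * (L * sieveCost α t n)) := by
  filter_upwards [eventually_one_le_log, eventually_maxDim hα ht₀ ht hL,
    eventually_ge_atTop 2] with n hl ⟨_, _, hdim, _⟩ hn
  set N := maxDim α t L n
  have hn0 : (0 : ℝ) < n := by exact_mod_cast two_pos.trans_le hn
  have hdims : (N : ℝ) + 1 ≤ exp (N * log n) :=
    (Real.add_one_le_exp _).trans (Real.exp_le_exp.2 (le_mul_of_one_le_right (by positivity) hl))
  have hcells : ((2 * n ^ k + 1 : ℕ) : ℝ) ≤ exp ((k + 2) * log n) := by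
    have hpow : 2 * n ^ k + 1 ≤ n ^ (k + 2) :=
      calc 2 * n ^ k + 1 ≤ n ^ k * 4 := by have := Nat.one_le_pow k n (by omega); omega
        _ ≤ n ^ k * n ^ 2 := Nat.mul_le_mul_left _ (by nlinarith)
        _ = n ^ (k + 2) := (pow_add _ _ _).symm
    have hexp : exp ((k + 2) * log n) = (n : ℝ) ^ (k + 2) := by
      rw [← Real.exp_log (pow_pos hn0 (k + 2)), Real.log_pow]
      push_cast
      rfl
    rw [hexp]
    exact_mod_cast hpow
  calc ((N : ℝ) + 1) * ((2 * n ^ k + 1 : ℕ) : ℝ) ^ (q * N)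
      ≤ exp (N * log n) * exp ((k + 2) * log n) ^ (q * N) := by gcongr
    _ = exp ((1 + q * (k + 2)) * (N * log n)) := by
        rw [← Real.exp_nat_mul, ← Real.exp_add]
        push_cast
        ring_nf
    _ ≤ exp ((1 + q * (k + 2)) * (L * sieveCost α t n)) := by gcongr

lemma BasisStable.exists_eventually_abs_series_sub_le (h : BasisStable ψ K₀) (hK₀ : 0 ≤ K₀) :
    ∃ k : ℕ, ∀ᶠ n : ℕ in atTop, ∀ J : ℕ, (J : ℝ) ≤ n ^ 2 → ∀ θ θ' : Fin J → ℝ,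
      (∀ j, |θ j - θ' j| ≤ ((n : ℝ) ^ k)⁻¹) →
        ∀ t ∈ Set.Icc (0 : ℝ) 1, |series ψ θ t - series ψ θ' t| ≤ ((n : ℝ) ^ 5)⁻¹ := by
  obtain ⟨C, _, h⟩ := h.exists_abs_series_sub_le
  set k := ⌈2 * K₀⌉₊
  refine ⟨k + 8, ?_⟩
  filter_upwards [eventually_ge_atTop 1, tendsto_natCast_atTop_atTop.eventually_ge_atTop C]
    with n hn hCn J hJ θ θ' hθ t ht
  have hn1 : (1 : ℝ) ≤ n := by exact_mod_cast hn
  have hpow : (J : ℝ) ^ K₀ ≤ (n : ℝ) ^ k :=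
    calc (J : ℝ) ^ K₀ ≤ ((n : ℝ) ^ 2) ^ K₀ := Real.rpow_le_rpow (by positivity) hJ hK₀
      _ = (n : ℝ) ^ (2 * K₀) := by rw [← Real.rpow_natCast_mul (by positivity), Nat.cast_ofNat]
      _ ≤ (n : ℝ) ^ k := by
        rw [← Real.rpow_natCast]
        exact Real.rpow_le_rpow_of_exponent_le hn1 (Nat.le_ceil _)
  calc |series ψ θ t - series ψ θ' t| ≤ C * (J : ℝ) ^ K₀ * (J * ((n : ℝ) ^ (k + 8))⁻¹) :=
        h J θ θ' _ (by positivity) hθ t ht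
    _ ≤ n * (n : ℝ) ^ k * (n ^ 2 * ((n : ℝ) ^ (k + 8))⁻¹) := by gcongr
    _ = ((n : ℝ) ^ 5)⁻¹ := by
        rw [pow_add]
        field_simp

lemma exists_eventually_exists_mem_sieve_le (hψ : ∀ J j, BddCoef (ψ J j))
    (h₀ : ∀ l, BddCoef (β₀ l)) (hR : ∀ᵐ x ∂G, ‖x‖ ≤ R) (hα : 0 < α) (hK₀ : 0 ≤ K₀) (ht₀ : 0 ≤ t)
    (ht : t ≤ 1) (hStable : BasisStable ψ K₀) {L : ℝ} (hL : 2 ≤ L) (m : ℕ) :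
    ∃ b : ℝ, ∀ᶠ n : ℕ in atTop, ∀ η ≥ 0, iidLaw (obsLaw G β₀) n
        {D | ∃ p ∈ {p | η ≤ catDist G (coefFun ψ p) β₀} ∩ sieve q (maxDim α t L n) ((n : ℝ) ^ m),
          ENNReal.ofReal (exp (-(n * η ^ 2 / 8))) < ∏ i, likRatio (coefFun ψ p) β₀ (D i)} ≤
      ENNReal.ofReal (exp (b * sieveCost α t n - n * η ^ 2 / 16)) := by
  obtain ⟨k, hk⟩ := hStable.exists_eventually_abs_series_sub_le hK₀
  refine ⟨(1 + q * ((m + k : ℕ) + 2)) * L + (q + 1), ?_⟩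
  filter_upwards [eventually_maxDim hα ht₀ ht hL, eventually_card_cells_le hα ht₀ ht hL q (m + k),
    hk, eventually_ge_atTop 1, (tendsto_optCost_atTop hα).eventually_ge_atTop 1,
    eventually_optCost_le_sieveCost hα ht,
    tendsto_natCast_atTop_atTop.eventually_ge_atTop (2 * (q + 1) * R)]
    with n ⟨_, _, _, hdim⟩ hcells hk hn hcost hcost' hnR η hη
  have hn1 : (1 : ℝ) ≤ n := by exact_mod_cast hn
  have hwidth : 2 * (n : ℝ) ^ m / ((n : ℝ) ^ k)⁻¹ < (2 * n ^ (m + k) + 1 : ℕ) := by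
    rw [div_inv_eq_mul, mul_assoc, ← pow_add]
    push_cast
    linarith
  have hδ : 2 * (q + 1) * R * ((n : ℝ) ^ 5)⁻¹ ≤ ((n : ℝ) ^ 4)⁻¹ :=
    calc 2 * (q + 1) * R * ((n : ℝ) ^ 5)⁻¹ ≤ n * ((n : ℝ) ^ 5)⁻¹ := by gcongr
      _ = ((n : ℝ) ^ 4)⁻¹ := by field_simp
  have hsqrt : n * ((q + 1) * √((n : ℝ) ^ 4)⁻¹) ≤ (q + 1) * sieveCost α t n := by
    rw [Real.sqrt_inv, show (n : ℝ) ^ 4 = ((n : ℝ) ^ 2) ^ 2 by ring, Real.sqrt_sq (by positivity)]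
    calc n * ((q + 1) * ((n : ℝ) ^ 2)⁻¹) = (q + 1) * (n : ℝ)⁻¹ := by field_simp
      _ ≤ (q + 1) * sieveCost α t n := by
          gcongr
          exact (inv_le_one_of_one_le₀ hn1).trans (hcost.trans hcost')
  refine (measure_exists_mem_sieve_lt_prod_le hR hψ h₀ (by positivity) hwidth (by omega)
    (by positivity) (by positivity) hη (fun J hJ => hk J (le_trans (by exact_mod_cast hJ) hdim))
    hδ _).trans (ENNReal.ofReal_le_ofReal ?_)
  refine (mul_le_mul_of_nonneg_right hcells (Real.exp_nonneg _)).trans ?_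
  rw [← Real.exp_add, Real.exp_le_exp]
  linarith

lemma exists_eventually_le_posteriorProb_le (hψ : ∀ J j, BddCoef (ψ J j))
    (h₀ : ∀ l, BddCoef (β₀ l)) (hR : ∀ᵐ x ∂G, ‖x‖ ≤ R) (hα : 0 < α) (hK₀ : 0 ≤ K₀) (ht₀ : 0 ≤ t₂)
    (ht : t₂ ≤ 1) (ht₁ : t₁ ≤ 1) (hStable : BasisStable ψ K₀)
    (hApprox : ∀ l, BasisApprox ψ (β₀ l) α H) (hDim : DimPriorCond ρ t₁ t₂)
    (hConc : CoefPriorConc τ H) (hTail : CoefPriorTail τ) :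
    ∃ w : ℝ, ∀ᶠ n : ℕ in atTop, ∀ η ≥ 0, w * sieveCost α t₂ n ≤ n * η ^ 2 →
      ∀ δ > ENNReal.ofReal (2 * exp (-optCost α n)),
        iidLaw (obsLaw G β₀) n
            {D | δ ≤ posteriorProb (prior ρ τ) ψ D {p | η ≤ catDist G (coefFun ψ p) β₀}} ≤
          ENNReal.ofReal (3 * exp (-optCost α n)) := by
  have := isProbabilityMeasure_obsLaw (G := G) h₀
  obtain ⟨a, ha, hevidence⟩ :=
    exists_eventually_evidence_lt_le hψ h₀ hR hα hK₀ ht₁ hStable hApprox hDim hConc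
  obtain ⟨L, hL, m, hcompl⟩ := exists_eventually_prior_compl_sieve_le (q := q) hα ht₀ ht hDim hTail
    (show 0 ≤ a + 2 by positivity)
  obtain ⟨b, hsieve⟩ :=
    exists_eventually_exists_mem_sieve_le hψ h₀ hR hα hK₀ ht₀ ht hStable hL m
  refine ⟨16 * (|b| + a + 1), ?_⟩
  filter_upwards [hevidence, hcompl, hsieve, eventually_optCost_le_sieveCost hα ht,
    (tendsto_optCost_atTop hα).eventually_ge_atTop 0] with n hevidence hcompl hsieve hcost hS η hη
    hw δ hδ
  set S := optCost α n
  set T := sieveCost α t₂ n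
  have hT : 0 ≤ T := hS.trans hcost
  have hbT : b * T ≤ |b| * T := mul_le_mul_of_nonneg_right (le_abs_self b) hT
  have habs : 0 ≤ |b| * T := by positivity
  have haST : (a + 1) * S ≤ (a + 1) * T := by gcongr
  have haS : 0 ≤ a * S := by positivity
  have hlower : exp (a * S - n * η ^ 2 / 8) + exp (a * S - (a + 1) * S) ≤ 2 * exp (-S) := by
    rw [two_mul]
    gcongr <;> linarith
  have hupper : exp (-S) + exp (b * T - n * η ^ 2 / 16) + exp (-((a + 2) * S) + (a + 1) * S) ≤
      3 * exp (-S) := by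
    rw [show 3 * exp (-S) = exp (-S) + exp (-S) + exp (-S) by ring]
    gcongr <;> linarith
  simp only [posteriorProb_eq_div _ ψ β₀]
  refine (measure_le_posterior_le (c := (a + 1) * S) (measurable_likRatio_coefFun hψ h₀)
    (fun p => (lintegral_likRatio (fun l => bddCoef_series (hψ _) _) h₀).le)
    (measurableSet_sieve q _ _) hevidence (hsieve η hη) hcompl (lt_of_le_of_lt ?_ hδ)).trans ?_
  · rw [← ENNReal.ofReal_add (by positivity) (by positivity)]
    exact ENNReal.ofReal_le_ofReal hlower
  · rw [ofReal_exp_mul_ofReal_exp, ← ENNReal.ofReal_add (by positivity) (by positivity),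
      ← ENNReal.ofReal_add (by positivity) (by positivity)]
    exact ENNReal.ofReal_le_ofReal hupper

end Contraction

lemma eventually_mul_sieveCost_le {α t : ℝ} (hα : 0 < α) {M ε : ℕ → ℝ}
    (hM : Tendsto M atTop atTop) (hε₀ : ∀ n, 0 ≤ ε n)
    (hε : contractionRate α t =O[atTop] ε) (w : ℝ) :
    ∀ᶠ n : ℕ in atTop, 0 ≤ M n * ε n ∧ w * sieveCost α t n ≤ n * (M n * ε n) ^ 2 := by
  obtain ⟨c, hc, hbound⟩ := hε.exists_pos
  filter_upwards [hbound.bound, eventually_mul_contractionRate_sq hα t,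
    hM.eventually_ge_atTop (c * max w 1)] with n hbound hrate hMn
  set r := contractionRate α t n
  set v := max w 1
  have hv : 1 ≤ v := le_max_right _ _
  have hM₀ : 0 ≤ M n := le_trans (by positivity) hMn
  rw [Real.norm_eq_abs, Real.norm_of_nonneg (hε₀ n)] at hbound
  have hle : v * |r| ≤ M n * ε n :=
    calc v * |r| ≤ v * (c * ε n) := by gcongr
      _ = c * v * ε n := by ring
      _ ≤ M n * ε n := mul_le_mul_of_nonneg_right hMn (hε₀ n)
  refine ⟨mul_nonneg hM₀ (hε₀ n), ?_⟩
  calc w * sieveCost α t n = w * (n * r ^ 2) := by rw [hrate]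
    _ ≤ v ^ 2 * (n * r ^ 2) := by
        gcongr
        exact (le_max_left w 1).trans (le_self_pow₀ hv two_ne_zero)
    _ = n * (v * |r|) ^ 2 := by rw [mul_pow, sq_abs]; ring
    _ ≤ n * (M n * ε n) ^ 2 := by gcongr

lemma BasisStable.mono {ψ : (J : ℕ) → Fin J → ℝ → ℝ} {K K' : ℝ} (h : BasisStable ψ K)
    (hK : K ≤ K') : BasisStable ψ K' := by
  obtain ⟨C, hC, h⟩ := h
  refine ⟨C, hC, fun J hJ θ θ' t ht => (h J hJ θ θ' t ht).trans ?_⟩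
  gcongr
  exact_mod_cast hJ

end FunProbit

end

open FunProbit in
theorem theorem3_general {q : ℕ} {G : Measure Curve} [IsProbabilityMeasure G]
    (hX : ∃ M : ℝ, ∀ᵐ x ∂G, ‖x‖ ≤ M) {ψ : (J : ℕ) → Fin J → ℝ → ℝ}
    (hψ : ∀ J j, Measurable (ψ J j)) {β₀ : Fin q → ℝ → ℝ} {α H K₀ : ℝ} (hα : 0 < α)
    (hApprox : ∀ l, BasisApprox ψ (β₀ l) α H) (hStable : BasisStable ψ K₀)
    {ρ : Measure ℕ} [IsProbabilityMeasure ρ] {τ : (J : ℕ) → Measure (Fin q → Fin J → ℝ)}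
    [∀ J, IsProbabilityMeasure (τ J)] {t₁ t₂ : ℝ} (ht₂ : 0 ≤ t₂) (ht₂' : t₂ ≤ 1) (ht₁ : t₁ ≤ 1)
    (hDim : DimPriorCond ρ t₁ t₂) (hConc : CoefPriorConc τ H) (hTail : CoefPriorTail τ)
    {ε : ℕ → ℝ} (hε₀ : ∀ n, 0 ≤ ε n) (hε : contractionRate α t₂ =O[atTop] ε) :
    ContractsAt G (prior ρ τ) ψ β₀ ε := by
  obtain ⟨R, hR⟩ := hX
  have hbasis : ∀ J j, BddCoef (ψ J j) := hStable.bddCoef_basis hψ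
  obtain ⟨w, hw⟩ := exists_eventually_le_posteriorProb_le hbasis
    (fun l => (hApprox l).bddCoef hα hbasis) hR hα (le_max_right K₀ 0) ht₂ ht₂' ht₁
    (hStable.mono (le_max_left K₀ 0)) hApprox hDim hConc hTail
  have hlim (c : ℝ) :
      Tendsto (fun n => ENNReal.ofReal (c * Real.exp (-optCost α n))) atTop (𝓝 0) := by
    simpa using ENNReal.tendsto_ofReal
      ((Real.tendsto_exp_neg_atTop_nhds_zero.comp (tendsto_optCost_atTop hα)).const_mul c)
  intro M hM δ hδ
  refine tendsto_of_tendsto_of_tendsto_of_le_of_le' tendsto_const_nhds (hlim 3)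
    (.of_forall fun _ => zero_le) ?_
  filter_upwards [hw, eventually_mul_sieveCost_le hα hM hε₀ hε w,
    (hlim 2).eventually_lt_const hδ] with n hw ⟨hη₀, hη⟩ hδ
  exact hw _ hη₀ hη δ hδ

theorem theorem3
    (q : ℕ) -- there are `K = q + 1` categories
    -- the law of the functional covariate, with bounded `L¹` norm
    (G : MeasureTheory.Measure FunProbit.Curve) [MeasureTheory.IsProbabilityMeasure G]
    (hX : ∃ M : ℝ, ∀ᵐ x ∂G, ‖x‖ ≤ M)
    -- the basis and the true coefficient functions
    (ψ : (J : ℕ) → Fin J → ℝ → ℝ) (hψ : ∀ J j, Measurable (ψ J j))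
    (β₀ : Fin q → ℝ → ℝ)
    (α H K₀ : ℝ) (hα : 0 < α) (hK₀ : 0 ≤ K₀)
    (hApprox : ∀ l, FunProbit.BasisApprox ψ (β₀ l) α H)
    (hStable : FunProbit.BasisStable ψ K₀)
    -- the prior
    (ρ : MeasureTheory.Measure ℕ) [MeasureTheory.IsProbabilityMeasure ρ]
    (τ : (J : ℕ) → MeasureTheory.Measure (Fin q → Fin J → ℝ))
    [∀ J, MeasureTheory.IsProbabilityMeasure (τ J)]
    (t₁ t₂ : ℝ) (ht₂ : 0 ≤ t₂) (ht₂₁ : t₂ ≤ t₁) (ht₁ : t₁ ≤ 1)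
    (hDim : FunProbit.DimPriorCond ρ t₁ t₂)
    (hConc : FunProbit.CoefPriorConc τ H)
    (hTail : FunProbit.CoefPriorTail τ)
    -- the rate
    (ε : ℕ → ℝ) (hε_pos : ∀ n, 0 < ε n)
    (hε : ε =Θ[atTop] fun n : ℕ =>
      (n : ℝ) ^ (-α / (2 * α + 1)) *
        Real.log n ^ (α / (2 * α + 1) + (1 - t₂) / 2)) :
    FunProbit.ContractsAt G (FunProbit.prior ρ τ) ψ β₀ ε :=
  theorem3_general hX hψ hα hApprox hStable ht₂ (ht₂₁.trans ht₁) ht₁ hDim hConc hTail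
    (fun n => (hε_pos n).le) hε.2
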